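/- **Theorem (the Jiffy queue implementation is linearizable).** Every execution of the Jiffy multi-producer single-consumer queue, with any buffer size $b\ge 1$, any set of producers and one consumer, is linearizable. *Linearizability.* A history is a finite sequence of invocation and termination events of operations. An operation $o_1$ appears before $o_2$ if $o_1$ terminates before $o_2$ is invoked. A history $\sigma$ is linearizable if there is a sequence $\sigma'$ of operations of $\sigma$, each occurring at most once and with a response, such that: $\sigma'$ contains all operations that terminate in $\sigma$, with the same responses as in $\sigma$ (it may also contain operations that are pending in $\sigma$, completed by some response); if $o_1$ appears before $o_2$ in $\sigma$ and both are in $\sigma'$, then $o_1$ precedes $o_2$ in $\sigma'$; and $\sigma'$ is a legal sequential execution of an initially empty FIFO queue, in which $\mathrm{enqueue}(v)$ appends $v$ and returns, and $\mathrm{dequeue}()$ removes and returns the first value, or returns *false* if the queue is empty. *The queue.* The shared memory is a doubly linked list of buffers. A buffer has an array of $b$ nodes, each with a field *data* and a flag *isSet* $\in\{\mathtt{empty},\mathtt{set},\mathtt{handled}\}$, initially $\mathtt{empty}$; pointers *next* and *prev*; an index *head*, initially $0$; and its *position* (the first buffer has position $1$; a new buffer has the position of its predecessor plus $1$). There are pointers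 *headOfQueue* and *tailOfQueue*, which initially point to a single buffer, and a counter *tail*, initially $0$. Node $i$ of a buffer of position $p$ has the global location $b(p-1)+i$. Memory is garbage collected. Any finite interleaving of steps of the threads is an execution, where each step makes at most one atomic access (load, store, CAS, FAA) to memory shared between threads. Producers only enqueue; the consumer only dequeues. *enqueue(v).* Obtain a location by FAA on *tail*. Repeat: load *tailOfQueue* into $T$; if the location is beyond $T$, then, if $T.next$ is null, allocate a buffer $N$ with $N.prev=T$ and try to CAS $T.next$ from null to $N$ (dropping $N$ on failure), and on success CAS *tailOfQueue* from $T$ to $N$; if $T.next$ is not null, CAS *tailOfQueue* from $T$ to $T.next$. When the location is not beyond $T$, follow *prev* from $T$ until the location is not before the buffer. Store $v$ in *data* of the node at the location, then store $\mathtt{set}$ in its *isSet*. If this is the second node of its buffer and no *prev* pointer was followed, then allocate a buffer and try to add it after this one by the same two CAS operations. Return. *dequeue().* 1. Let $n$ denote the element at index *head* of the buffer *headOfQueue*. While $n$ is $\mathtt{handled}$, increment this *head*. Whenever *head* is $b$, move *headOfQueue* to the next buffer; if *headOfQueue* equals *tailOfQueue* or there is no next buffer, return *false*. 2. If the global location of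 $n$ equals *tail*, return *false*. 3. Let $tempN=n$. If $n.isSet$ is $\mathtt{empty}$, then advance $tempN$ from $n$ on until $tempN.isSet$ is $\mathtt{set}$. Return *false* if an element not found $\mathtt{set}$ has a location that is not below *tail*, or if the next buffer is needed and does not exist. At the end of a buffer other than *headOfQueue* all of whose nodes were found $\mathtt{handled}$, unlink this buffer from the list by setting the *prev* pointer of its successor and the *next* pointer of its predecessor (return *false* instead if it is *tailOfQueue* or has no successor). 4. Check, one after the other, the elements from $n$ up to but excluding $tempN$. As soon as one is $\mathtt{set}$, it becomes $tempN$, and the check restarts from $n$. 5. Read the *data* of $tempN$ and set its *isSet* to $\mathtt{handled}$. If $tempN=n$, increment *head*, and if it is now $b$, move *headOfQueue* to the next buffer unless *headOfQueue* equals *tailOfQueue* or there is no next buffer. Return the data. -/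

import Mathlib

namespace Jiffy

/-! ### Histories, the sequential FIFO queue, linearizability -/

/-- The threads: arbitrarily many producers and one consumer. -/
inductive Thread (P : Type*) where
  | producer (t : P)
  | consumer

/-- Invocations of queue operations. -/
inductive Operation (V : Type*) where
  | enqueue (v : V)
  | dequeue

/-- What an operation returns. A dequeue returns `false` (the queue is empty) or `true` together
with the content of a data field; such a field holds `none` as long as nobody has written to it. -/
inductive Response (V : Type*) where
  | done
  | retFalse
  | retTrue (data : Option V)

/-- Events of a history: an operation is invoked, or terminates with a response. -/
inductive Event (P V : Type*) where
  | inv (t : Thread P) (op : Operation V)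
  | res (t : Thread P) (r : Response V)

/-- The thread of an event. -/
def Event.thread {P V : Type*} : Event P V → Thread P
  | .inv t _ => t
  | .res t _ => t

/-- The operations of a history are identified with the positions of their invocation events. -/
def IsOperation {P V : Type*} (σ : List (Event P V)) (i : ℕ) (op : Operation V) : Prop :=
  ∃ t, σ[i]? = some (.inv t op)

/-- The operation invoked at position `i` terminates at position `j` with response `r`: the event
at `j` is a response, and it is the next event of the invoking thread after position `i`. -/
def TerminatesAt {P V : Type*} (σ : List (Event P V)) (i j : ℕ) (r : Response V) : Prop :=
  ∃ t op, σ[i]? = some (.inv t op) ∧ i < j ∧ σ[j]? = some (.res t r) ∧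
    ∀ k e, i < k → k < j → σ[k]? = some e → e.thread ≠ t

/-- Real-time order: operation `i` terminates before operation `k` is invoked. -/
def AppearsBefore {P V : Type*} (σ : List (Event P V)) (i k : ℕ) : Prop :=
  ∃ j r, TerminatesAt σ i j r ∧ j < k ∧ ∃ op, IsOperation σ k op

/-- Sequential specification of the FIFO queue: the legal sequences of operations and responses
that start with the queue content `q`, whose first entry is the head. -/
inductive LegalFrom {V : Type*} : List V → List (Operation V × Response V) → Prop where
  | nil (q : List V) : LegalFrom q []
  | enqueue (q : List V) (v : V) (l : List (Operation V × Response V)) :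
      LegalFrom (q ++ [v]) l → LegalFrom q ((.enqueue v, .done) :: l)
  | dequeue (q : List V) (v : V) (l : List (Operation V × Response V)) :
      LegalFrom q l → LegalFrom (v :: q) ((.dequeue, .retTrue (some v)) :: l)
  | dequeueEmpty (l : List (Operation V × Response V)) :
      LegalFrom [] l → LegalFrom [] ((.dequeue, .retFalse) :: l)

/-- One entry of a sequential execution `σ'` of operations of a history `σ`: which operation of
`σ` it is, its invocation, and its response. -/
structure SeqOp (V : Type*) where
  index : ℕ
  op : Operation V
  response : Response V

/-- Linearizability (Herlihy and Wing): there is a sequential execution `σ'` made of all operations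
that terminate in `σ`, with the responses they have in `σ`, and possibly of some operations that
are pending in `σ`, which is legal and respects the real-time order of `σ`. -/
def Linearizable {P V : Type*} (σ : List (Event P V)) : Prop :=
  ∃ σ' : List (SeqOp V),
    (σ'.map SeqOp.index).Nodup ∧
    (∀ o ∈ σ', IsOperation σ o.index o.op ∧
      ∀ j r, TerminatesAt σ o.index j r → o.response = r) ∧
    (∀ i j r, TerminatesAt σ i j r → ∃ o ∈ σ', o.index = i) ∧
    σ'.Pairwise (fun o₁ o₂ => ¬ AppearsBefore σ o₂.index o₁.index) ∧
    LegalFrom [] (σ'.map fun o => (o.op, o.response))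

/-! ### The shared memory of the queue -/

/-- The values of the field `isSet`. -/
inductive Flag where
  | empty
  | set
  | handled
  deriving DecidableEq

/-- A node of a buffer. -/
structure Node (V : Type*) where
  data : Option V
  isSet : Flag

/-- Addresses of buffers. The null pointer is the `none` of `Option Ptr`. -/
abbrev Ptr := ℕ

/-- A buffer of the linked list. Its nodes are `currBuffer 0, …, currBuffer (bufferSize - 1)`. -/
structure BufferList (V : Type*) where
  currBuffer : ℕ → Node V
  next : Option Ptr
  prev : Option Ptr
  head : ℕ
  positionInQueue : ℕ

/-- A newly allocated buffer: all nodes are `empty`. -/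
def BufferList.new (V : Type*) (position : ℕ) (prev : Option Ptr) : BufferList V where
  currBuffer := fun _ => ⟨none, .empty⟩
  next := none
  prev := prev
  head := 0
  positionInQueue := position

/-- The shared memory. Memory is garbage collected: the addresses from `fresh` on have not been
allocated yet, an address is never reused, and deleting a buffer means to drop references to it. -/
structure Memory (V : Type*) where
  heap : Ptr → BufferList V
  fresh : Ptr
  headOfQueue : Ptr
  tailOfQueue : Ptr
  tail : ℕ

namespace Memory

variable {V : Type*}

/-- Change the buffer at address `p`. -/
def modify (m : Memory V) (p : Ptr) (f : BufferList V → BufferList V) : Memory V :=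
  { m with heap := Function.update m.heap p (f (m.heap p)) }

/-- Change entry `i` of the buffer at address `p`. -/
def modifyNode (m : Memory V) (p : Ptr) (i : ℕ) (f : Node V → Node V) : Memory V :=
  m.modify p fun B => { B with currBuffer := Function.update B.currBuffer i (f (B.currBuffer i)) }

/-- Entry `i` of the buffer at address `p`. -/
def node (m : Memory V) (p : Ptr) (i : ℕ) : Node V := (m.heap p).currBuffer i

/-- Allocate the buffer that is to follow the buffer `p`, at the address `m.fresh`. -/
def alloc (m : Memory V) (p : Ptr) : Memory V :=
  { m with
    heap := Function.update m.heap m.fresh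
      (BufferList.new V ((m.heap p).positionInQueue + 1) (some p))
    fresh := m.fresh + 1 }

/-- Number of entries of the queue in the buffers that precede the buffer `p`. -/
def prevSize (bufferSize : ℕ) (m : Memory V) (p : Ptr) : ℕ :=
  bufferSize * ((m.heap p).positionInQueue - 1)

/-- The index `head` of the first buffer. -/
def head (m : Memory V) : ℕ := (m.heap m.headOfQueue).head

/-- Increment the index `head` of the first buffer. -/
def advanceHead (m : Memory V) : Memory V :=
  m.modify m.headOfQueue fun B => { B with head := B.head + 1 }

/-- The initial memory: one buffer, at position 1, and no elements. -/
def init (V : Type*) : Memory V where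
  heap := fun _ => BufferList.new V 1 none
  fresh := 1
  headOfQueue := 0
  tailOfQueue := 0
  tail := 0

end Memory

/-! ### The enqueue operation -/

/-- Where an enqueue operation stands, with its local variables: `v` is the value to be enqueued,
`loc` the location obtained from `tail`, `tmp` is `tempTail`, `new` is the buffer to be added, and
`last` tells whether `tmp` is still the buffer that was read from `tailOfQueue`. -/
inductive EnqPC (V : Type*) where
  | idle
  | fetchAdd (v : V)
  | loadTail (v : V) (loc : ℕ)
  | loadNext (v : V) (loc : ℕ) (tmp : Ptr)
  | casNext (v : V) (loc : ℕ) (tmp new : Ptr)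
  | casTail (v : V) (loc : ℕ) (tmp new : Ptr)
  | walkBack (v : V) (loc : ℕ) (tmp : Ptr) (last : Bool)
  | storeData (v : V) (loc : ℕ) (tmp : Ptr) (last : Bool)
  | storeSet (loc : ℕ) (tmp : Ptr) (last : Bool)
  | preAlloc (tmp : Ptr)
  | preCasNext (tmp new : Ptr)
  | preCasTail (tmp new : Ptr)
  | ret

/-- One step of an enqueue operation; it makes at most one access to mutable shared memory.
The result is `none` if there is no such step (idle, about to return, or a null dereference). -/
def enqStep {V : Type*} (bufferSize : ℕ) (m : Memory V) :
    EnqPC V → Option (Memory V × EnqPC V)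
  | .idle => none
  -- `location = FAA(tail)`
  | .fetchAdd v => some ({ m with tail := m.tail + 1 }, .loadTail v m.tail)
  -- `tempTail = tailOfQueue`; is `location` in a buffer that is not allocated yet?
  | .loadTail v loc =>
      if bufferSize * (m.heap m.tailOfQueue).positionInQueue ≤ loc then
        some (m, .loadNext v loc m.tailOfQueue)
      else some (m, .walkBack v loc m.tailOfQueue true)
  -- if there is a next buffer already, only move `tailOfQueue`; otherwise allocate a new one
  | .loadNext v loc tmp =>
      match (m.heap tmp).next with
      | some nxt => some (m, .casTail v loc tmp nxt)
      | none => some (m.alloc tmp, .casNext v loc tmp m.fresh)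
  -- `CAS(tempTail.next, NULL, new)`; on failure `new` is dropped
  | .casNext v loc tmp new =>
      if (m.heap tmp).next = none then
        some (m.modify tmp fun B => { B with next := some new }, .casTail v loc tmp new)
      else some (m, .loadTail v loc)
  -- `CAS(tailOfQueue, tempTail, new)`, then back to the loop test
  | .casTail v loc tmp new =>
      if m.tailOfQueue = tmp then some ({ m with tailOfQueue := new }, .loadTail v loc)
      else some (m, .loadTail v loc)
  -- `while location is before tempTail: tempTail = tempTail.prev`
  | .walkBack v loc tmp last =>
      if loc < m.prevSize bufferSize tmp then
        match (m.heap tmp).prev with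
        | some p => some (m, .walkBack v loc p false)
        | none => none
      else some (m, .storeData v loc tmp last)
  -- `tempTail[index].data = data`
  | .storeData v loc tmp last =>
      some (m.modifyNode tmp (loc - m.prevSize bufferSize tmp) fun n => { n with data := some v },
        .storeSet loc tmp last)
  -- `tempTail[index].isSet = set`; for the second entry of the last buffer, go on to add a buffer
  | .storeSet loc tmp last =>
      some (m.modifyNode tmp (loc - m.prevSize bufferSize tmp) fun n => { n with isSet := .set },
        if loc - m.prevSize bufferSize tmp = 1 ∧ last = true then .preAlloc tmp else .ret)
  | .preAlloc tmp => some (m.alloc tmp, .preCasNext tmp m.fresh)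
  | .preCasNext tmp new =>
      if (m.heap tmp).next = none then
        some (m.modify tmp fun B => { B with next := some new }, .preCasTail tmp new)
      else some (m, .ret)
  | .preCasTail tmp new =>
      if m.tailOfQueue = tmp then some ({ m with tailOfQueue := new }, .ret) else some (m, .ret)
  | .ret => none

/-! ### The dequeue operation -/

/-- Where the dequeue operation stands, with its local variables. Elements of the queue are given
by a buffer and an index in it; `n` is always the element given by `headOfQueue` and its `head`.
In `scan`, the pair `p, i` is `tempN`, and `all` tells whether all entries of `p` read so far were
`handled`; in `rescan`, `e` is the loop variable and `tempN` the element to be dequeued. -/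
inductive DeqPC (V : Type*) where
  | idle
  | skip
  | skipMoveTail
  | skipMoveNext
  | checkEmpty
  | checkFirst
  | scan (p : Ptr) (i : ℕ) (all : Bool)
  | scanTail (p : Ptr) (i : ℕ) (all : Bool)
  | scanNext (p : Ptr)
  | foldTail (p : Ptr)
  | foldNext (p : Ptr)
  | foldPrev (p nxt : Ptr)
  | foldLink (prv nxt : Ptr)
  | rescan (e tempN : Ptr × ℕ)
  | rescanNext (p : Ptr) (tempN : Ptr × ℕ)
  | loadData (tempN : Ptr × ℕ)
  | markHandled (tempN : Ptr × ℕ) (data : Option V)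
  | moveTail (data : Option V)
  | moveNext (data : Option V)
  | ret (r : Response V)

/-- One step of the dequeue operation; it makes at most one access to shared memory that other
threads may change or observe (`headOfQueue` and the `head` fields are used by the consumer only).
The result is `none` if there is no such step (idle, about to return, or a null dereference). -/
def deqStep {V : Type*} (bufferSize : ℕ) (m : Memory V) :
    DeqPC V → Option (Memory V × DeqPC V)
  | .idle => none
  -- skip to the first element that is not `handled`, moving to the next buffer at the end of one
  | .skip =>
      if bufferSize ≤ m.head then some (m, .skipMoveTail)
      else if (m.node m.headOfQueue m.head).isSet = .handled then some (m.advanceHead, .skip)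
      else some (m, .checkEmpty)
  | .skipMoveTail =>
      if m.headOfQueue = m.tailOfQueue then some (m, .ret .retFalse) else some (m, .skipMoveNext)
  | .skipMoveNext =>
      match (m.heap m.headOfQueue).next with
      | none => some (m, .ret .retFalse)
      | some nxt => some ({ m with headOfQueue := nxt }, .skip)
  -- `if the queue is empty: return false`
  | .checkEmpty =>
      if m.prevSize bufferSize m.headOfQueue + m.head = m.tail then some (m, .ret .retFalse)
      else some (m, .checkFirst)
  -- if `n` is `empty`, scan for an element that is `set`; otherwise `tempN` is `n`
  | .checkFirst =>
      if (m.node m.headOfQueue m.head).isSet = .empty then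
        some (m, .scan m.headOfQueue m.head true)
      else some (m, .rescan (m.headOfQueue, m.head) (m.headOfQueue, m.head))
  -- `for (tempN = n; tempN.isSet != set and not end of queue; advance tempN)`
  | .scan p i all =>
      if (m.node p i).isSet = .set then some (m, .rescan (m.headOfQueue, m.head) (p, i))
      else some (m, .scanTail p i (all && decide ((m.node p i).isSet = .handled)))
  | .scanTail p i all =>
      if m.tail ≤ m.prevSize bufferSize p + i then some (m, .ret .retFalse)
      else if i + 1 < bufferSize then some (m, .scan p (i + 1) all)
      else if all = true ∧ p ≠ m.headOfQueue then some (m, .foldTail p)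
      else some (m, .scanNext p)
  | .scanNext p =>
      match (m.heap p).next with
      | none => some (m, .ret .retFalse)
      | some nxt => some (m, .scan nxt (m.heap nxt).head true)
  -- fold: unlink the buffer `p`, all of whose entries are `handled`
  | .foldTail p =>
      if p = m.tailOfQueue then some (m, .ret .retFalse) else some (m, .foldNext p)
  | .foldNext p =>
      match (m.heap p).next with
      | none => some (m, .ret .retFalse)
      | some nxt => some (m, .foldPrev p nxt)
  | .foldPrev p nxt =>
      match (m.heap p).prev with
      | none => none
      | some prv => some (m.modify nxt fun B => { B with prev := some prv }, .foldLink prv nxt)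
  | .foldLink prv nxt =>
      some (m.modify prv fun B => { B with next := some nxt }, .scan nxt (m.heap nxt).head true)
  -- look for an element before `tempN` that is `set`; if there is one, restart with it as `tempN`
  | .rescan e tempN =>
      if e = tempN then some (m, .loadData tempN)
      else if (m.node e.1 e.2).isSet = .set then some (m, .rescan (m.headOfQueue, m.head) e)
      else if e.2 + 1 < bufferSize then some (m, .rescan (e.1, e.2 + 1) tempN)
      else some (m, .rescanNext e.1 tempN)
  | .rescanNext p tempN =>
      match (m.heap p).next with
      | none => none
      | some nxt => some (m, .rescan (nxt, (m.heap nxt).head) tempN)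
  -- remove `tempN`
  | .loadData tempN => some (m, .markHandled tempN (m.node tempN.1 tempN.2).data)
  | .markHandled tempN data =>
      let m' := m.modifyNode tempN.1 tempN.2 fun n => { n with isSet := .handled }
      if tempN = (m.headOfQueue, m.head) then
        some (m'.advanceHead,
          if bufferSize ≤ m.head + 1 then .moveTail data else .ret (.retTrue data))
      else some (m', .ret (.retTrue data))
  -- the first buffer has been read entirely: move to the next buffer if there is one
  | .moveTail data =>
      if m.headOfQueue = m.tailOfQueue then some (m, .ret (.retTrue data))
      else some (m, .moveNext data)
  | .moveNext data =>
      match (m.heap m.headOfQueue).next with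
      | none => some (m, .ret (.retTrue data))
      | some nxt => some ({ m with headOfQueue := nxt }, .ret (.retTrue data))
  | .ret _ => none

/-! ### Executions -/

/-- Global states: the shared memory, and where each producer and the consumer stand. -/
structure State (P V : Type*) where
  mem : Memory V
  enq : P → EnqPC V
  deq : DeqPC V

/-- The initial state. -/
def State.init (P V : Type*) : State P V where
  mem := Memory.init V
  enq := fun _ => .idle
  deq := .idle

/-- `Step bufferSize s l s'`: some thread takes a step from `s` to `s'`, and `l` is the list of
events of this step (one invocation or termination, or nothing for a step inside an operation). -/
inductive Step {P V : Type*} [DecidableEq P] (bufferSize : ℕ) :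
    State P V → List (Event P V) → State P V → Prop where
  | enqInvoke (s : State P V) (t : P) (v : V) (h : s.enq t = .idle) :
      Step bufferSize s [.inv (.producer t) (.enqueue v)]
        { s with enq := Function.update s.enq t (.fetchAdd v) }
  | enqStep (s : State P V) (t : P) (m : Memory V) (pc : EnqPC V)
      (h : enqStep bufferSize s.mem (s.enq t) = some (m, pc)) :
      Step bufferSize s [] { s with mem := m, enq := Function.update s.enq t pc }
  | enqReturn (s : State P V) (t : P) (h : s.enq t = .ret) :
      Step bufferSize s [.res (.producer t) .done]
        { s with enq := Function.update s.enq t .idle }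
  | deqInvoke (s : State P V) (h : s.deq = .idle) :
      Step bufferSize s [.inv .consumer .dequeue] { s with deq := .skip }
  | deqStep (s : State P V) (m : Memory V) (pc : DeqPC V)
      (h : deqStep bufferSize s.mem s.deq = some (m, pc)) :
      Step bufferSize s [] { s with mem := m, deq := pc }
  | deqReturn (s : State P V) (r : Response V) (h : s.deq = .ret r) :
      Step bufferSize s [.res .consumer r] { s with deq := .idle }

/-- From the initial state, finitely many steps of the threads, interleaved in any way, lead to the
state `s` and produce the history `σ`. -/
inductive Reaches {P V : Type*} [DecidableEq P] (bufferSize : ℕ) :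
    List (Event P V) → State P V → Prop where
  | init : Reaches bufferSize [] (State.init P V)
  | step (σ l : List (Event P V)) (s s' : State P V) :
      Reaches bufferSize σ s → Step bufferSize s l s' → Reaches bufferSize (σ ++ l) s'

/-- `σ` is the history of an execution of the queue. -/
def IsExecution {P V : Type*} [DecidableEq P] (bufferSize : ℕ) (σ : List (Event P V)) : Prop :=
  ∃ s : State P V, Reaches bufferSize σ s

end Jiffy

/-!
The proof is by forward simulation. The linked list of buffers is viewed as one unbounded array of
cells, indexed by locations, and every reachable state is shown to be represented by an abstract
queue (`Abs`) on such an array, which carries the history and a linearization of it (`Sim`,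
`Reaches.exists_sim`).

The linearization points are the following. A dequeue is linearized at its latest *snapshot*: the
moment when it starts to scan, or when the element that it is about to remove is selected, or, if
it returns `false` without a scan, when it finds out that there is nothing to remove. A cell
that is `set` remains so until the consumer handles it, so a cell that the search finds not to be
`set` after the snapshot was not `set` at the snapshot either. Hence the element that is finally
removed is the first one that was set at the snapshot, and when `false` is returned, nothing was
set then. Whether the snapshot was the last one is known only later; therefore the linearization
`Abs.seq` leaves out the enqueues whose cells have been set since the snapshot (`Abs.fresh`), and
the dequeue is appended to it (`Abs.Inv.commitDequeue`, `Abs.Inv.commitEmpty`) before they enter.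

Enqueues enter at a snapshot (`Abs.Inv.snapshot`), each one right before the first element of the
queue with a larger location, so that the queue remains sorted by location (`Witness.insert`). This
may put an enqueue `w` before operations that have been linearized earlier. It does not violate the
real-time order: all that comes from an element `e` of the queue on terminates only after `e` got
its location, and `w` got its smaller location before that, so it was invoked even earlier.

In the memory, the essential point is that the pointers `next` and `prev` skip only buffers whose
cells are all `handled` (`MemInv`). Thus the consumer does not miss an element, and a producer that
follows `prev` finds the buffer of its location, whose cell is still `empty`. Moreover, no cell
beyond the buffer `tailOfQueue` has been written, which justifies the returns of `false` at the end
of the list.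
-/

namespace Jiffy

/-! ### Linearizations under construction -/

/-- What is recorded about an enqueue operation when it obtains its location: its thread, its
value, the position `index` of its invocation in the history, its location, and the length `time`
of the history at that moment. -/
structure Ticket (P V : Type*) where
  thread : P
  val : V
  index : ℕ
  loc : ℕ
  time : ℕ

/-- An entry of a linearization: the enqueue with a given ticket, or the dequeue invoked at
position `i`, which removes the element of a ticket or finds the queue empty (`none`). -/
inductive Entry (P V : Type*) where
  | enq (x : Ticket P V)
  | deq (i : ℕ) (x : Option (Ticket P V))

/-- The position of the invocation of an entry in the history. -/
def Entry.index {P V : Type*} : Entry P V → ℕ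
  | .enq x => x.index
  | .deq i _ => i

/-- The response of an entry. -/
def Entry.response {P V : Type*} : Entry P V → Response V
  | .enq _ => .done
  | .deq _ none => .retFalse
  | .deq _ (some x) => .retTrue (some x.val)

/-- An entry as an operation of a sequential execution. -/
def Entry.toSeqOp {P V : Type*} (y : Entry P V) : SeqOp V where
  index := y.index
  op := match y with
    | .enq x => .enqueue x.val
    | .deq _ _ => .dequeue
  response := y.response

/-- `Runs q S q'`: the entries `S` are a legal sequential execution that starts with the queue
content `q` and ends with the queue content `q'`. -/
inductive Runs {P V : Type*} : List (Ticket P V) → List (Entry P V) → List (Ticket P V) → Prop where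
  | nil (q : List (Ticket P V)) : Runs q [] q
  | enq {q q' : List (Ticket P V)} {S : List (Entry P V)} (x : Ticket P V) :
      Runs (q ++ [x]) S q' → Runs q (.enq x :: S) q'
  | deq {q q' : List (Ticket P V)} {S : List (Entry P V)} (i : ℕ) (x : Ticket P V) :
      Runs q S q' → Runs (x :: q) (.deq i (some x) :: S) q'
  | deqEmpty {q' : List (Ticket P V)} {S : List (Entry P V)} (i : ℕ) :
      Runs [] S q' → Runs [] (.deq i none :: S) q'

section Runs

variable {P V : Type*} {q q' q'' : List (Ticket P V)} {S S' A B : List (Entry P V)}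
  {e w : Ticket P V}

theorem Runs.legalFrom (h : Runs q S q') :
    LegalFrom (q.map Ticket.val) ((S.map Entry.toSeqOp).map fun o => (o.op, o.response)) := by
  induction h with
  | nil q => exact .nil _
  | enq x _ ih => exact .enqueue _ _ _ (by simpa using ih)
  | deq i x _ ih => exact .dequeue _ _ _ ih
  | deqEmpty i _ ih => exact .dequeueEmpty _ ih

theorem Runs.append (h : Runs q S q') (h' : Runs q' S' q'') : Runs q (S ++ S') q'' := by
  induction h with
  | nil q => exact h'
  | enq x _ ih => exact .enq _ (ih h')
  | deq i x _ ih => exact .deq _ _ (ih h')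
  | deqEmpty i _ ih => exact .deqEmpty _ (ih h')

theorem Runs.of_append : ∀ {A : List (Entry P V)} {q : List (Ticket P V)}, Runs q (A ++ B) q'' →
    ∃ q', Runs q A q' ∧ Runs q' B q''
  | [], q, h => ⟨q, .nil _, h⟩
  | a :: A, q, h => by
    rw [List.cons_append] at h
    cases h with
    | enq x h => obtain ⟨q', h₁, h₂⟩ := Runs.of_append h; exact ⟨q', .enq _ h₁, h₂⟩
    | deq i x h => obtain ⟨q', h₁, h₂⟩ := Runs.of_append h; exact ⟨q', .deq _ _ h₁, h₂⟩
    | deqEmpty i h => obtain ⟨q', h₁, h₂⟩ := Runs.of_append h; exact ⟨q', .deqEmpty _ h₁, h₂⟩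

theorem Runs.mem_or_enq_mem (h : Runs q S q') (he : e ∈ q') : e ∈ q ∨ .enq e ∈ S := by
  induction h with
  | nil q => exact .inl he
  | enq x _ ih =>
    have := ih he
    simp only [List.mem_append, List.mem_singleton] at this
    simp only [List.mem_cons, Entry.enq.injEq]
    tauto
  | deq i x _ ih => have := ih he; simp only [List.mem_cons]; tauto
  | deqEmpty i _ ih => have := ih he; simp only [List.mem_cons]; tauto

/-- An additional element `w` can be put into the queue right before an element `e` that stays in
the queue. -/
theorem Runs.insert_before (h : Runs q S q') (he : e ∈ q') (hS : .enq e ∉ S) :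
    ∀ q₁ q₂, q = q₁ ++ e :: q₂ → e ∉ q₂ →
      ∃ Q₁ Q₂, q' = Q₁ ++ e :: Q₂ ∧ Runs (q₁ ++ w :: e :: q₂) S (Q₁ ++ w :: e :: Q₂) := by
  induction h with
  | nil q => rintro q₁ q₂ rfl -; exact ⟨q₁, q₂, rfl, .nil _⟩
  | enq x _ ih =>
    rintro q₁ q₂ rfl h2
    simp only [List.mem_cons, Entry.enq.injEq, not_or] at hS
    obtain ⟨Q₁, Q₂, h₁, h₂⟩ := ih he hS.2 q₁ (q₂ ++ [x]) (by simp) (by simp [h2, hS.1])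
    exact ⟨Q₁, Q₂, h₁, .enq _ (by simpa using h₂)⟩
  | deq i x h ih =>
    intro q₁ q₂ hq h2
    simp only [List.mem_cons, not_or] at hS
    cases q₁ with
    | nil =>
      -- a dequeue of `e` would contradict that `e` stays in the queue
      simp only [List.nil_append, List.cons.injEq] at hq
      obtain ⟨rfl, rfl⟩ := hq
      rcases h.mem_or_enq_mem he with h | h
      · exact absurd h h2
      · exact absurd h hS.2
    | cons y q₁ =>
      simp only [List.cons_append, List.cons.injEq] at hq
      obtain ⟨rfl, rfl⟩ := hq
      obtain ⟨Q₁, Q₂, h₁, h₂⟩ := ih he hS.2 q₁ q₂ rfl h2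
      exact ⟨Q₁, Q₂, h₁, .deq _ _ h₂⟩
  | deqEmpty i h ih => intro q₁ q₂ hq; simp at hq

end Runs

/-- `S` is a linearization of some operations of the history `σ`, and `Q` is the queue content
after it, which is sorted by location. The condition `later` is what makes it possible to insert
further enqueues: whatever comes after an element of `Q` terminates only after this element got
its location. -/
structure Witness {P V : Type*} (σ : List (Event P V)) (S : List (Entry P V))
    (Q : List (Ticket P V)) : Prop where
  runs : Runs [] S Q
  sorted : Q.Pairwise (fun x y => x.loc < y.loc)
  nodup : (S.map Entry.index).Nodup
  order : S.Pairwise (fun y z => ¬ AppearsBefore σ z.index y.index)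
  later : S.Pairwise (fun y z => ∀ x ∈ Q, y = .enq x →
    ∀ j r, TerminatesAt σ z.index j r → x.time ≤ j)

section Witness

variable {P V : Type*} {σ : List (Event P V)} {S : List (Entry P V)} {Q : List (Ticket P V)}

theorem Witness.enq_mem (h : Witness σ S Q) {x : Ticket P V} (hx : x ∈ Q) : .enq x ∈ S := by
  simpa using h.runs.mem_or_enq_mem hx

/-- An enqueue is inserted right before the first element of the queue that has a larger location,
or at the end if there is none. -/
theorem Witness.insert (h : Witness σ S Q) (w : Ticket P V)
    (hnew : ∀ y ∈ S, y.index ≠ w.index)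
    (hloc : ∀ x ∈ Q, x.loc ≠ w.loc)
    (htime : ∀ x ∈ Q, w.loc < x.loc → w.time ≤ x.time)
    (hw : w.index < w.time)
    (hterm : ∀ x ∈ Q, ∀ j r, TerminatesAt σ x.index j r → x.time ≤ j)
    (hS : ∀ y ∈ S, ¬ AppearsBefore σ w.index y.index)
    (hQ : ∀ x ∈ Q, ∀ j r, TerminatesAt σ w.index j r → x.time ≤ j) :
    ∃ S' Q', Witness σ S' Q' ∧ S'.Perm (.enq w :: S) ∧ Q'.Perm (w :: Q) := by
  by_cases hex : ∃ x ∈ Q, w.loc < x.loc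
  · obtain ⟨e, ⟨heQ, hwe⟩, hmin⟩ := (measure (Ticket.loc (P := P) (V := V))).wf.has_min
      {x | x ∈ Q ∧ w.loc < x.loc} hex
    have hmin : ∀ x ∈ Q, w.loc < x.loc → e.loc ≤ x.loc := fun x hx hwx =>
      not_lt.1 (hmin x ⟨hx, hwx⟩)
    obtain ⟨A, B, hAB⟩ := List.append_of_mem (h.enq_mem heQ)
    obtain ⟨hr, hs, hn, ho, hl⟩ := h
    subst hAB
    obtain ⟨q, hA, hB⟩ := hr.of_append
    cases hB with
    | enq _ hB =>
    have heB : Entry.enq e ∉ B := by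
      intro hm
      rw [List.map_append, List.map_cons, List.nodup_append, List.nodup_cons] at hn
      exact hn.2.1.1 (List.mem_map_of_mem (f := Entry.index) hm)
    obtain ⟨Q₁, Q₂, rfl, hB'⟩ := hB.insert_before (w := w) heQ heB q [] rfl (by simp)
    have hewt : w.time ≤ e.time := htime e heQ hwe
    have hBt : ∀ z ∈ Entry.enq e :: B, ∀ j r, TerminatesAt σ z.index j r → w.time ≤ j := by
      intro z hz j r hj
      rcases List.mem_cons.1 hz with rfl | hz
      · exact hewt.trans (hterm e heQ j r hj)
      · exact hewt.trans
          ((List.pairwise_cons.1 (List.pairwise_append.1 hl).2.1).1 z hz e heQ rfl j r hj)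
    have hpQ : (Q₁ ++ w :: e :: Q₂).Perm (w :: (Q₁ ++ e :: Q₂)) := List.perm_middle
    have hpS : (A ++ Entry.enq w :: Entry.enq e :: B).Perm (.enq w :: (A ++ .enq e :: B)) :=
      List.perm_middle
    refine ⟨A ++ .enq w :: .enq e :: B, Q₁ ++ w :: e :: Q₂, ⟨?_, ?_, ?_, ?_, ?_⟩, hpS, hpQ⟩
    · exact hA.append (.enq _ (.enq _ (by simpa using hB')))
    · rw [List.pairwise_append] at hs ⊢
      refine ⟨hs.1, List.pairwise_cons.2 ⟨?_, hs.2.1⟩, ?_⟩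
      · intro a ha
        rcases List.mem_cons.1 ha with rfl | ha'
        · exact hwe
        · exact hwe.trans ((List.pairwise_cons.1 hs.2.1).1 a ha')
      · intro a ha c hc
        rcases List.mem_cons.1 hc with rfl | hc
        · -- `e` is the first element beyond `w`, so those before `e` are before `w`
          have h1 := hs.2.2 a ha e (by simp)
          have h2 := hmin a (by simp [ha])
          have h3 := hloc a (by simp [ha])
          omega
        · exact hs.2.2 a ha c hc
    · rw [(hpS.map Entry.index).nodup_iff, List.map_cons, List.nodup_cons]
      refine ⟨fun hm => ?_, hn⟩
      obtain ⟨y, hy, hyi⟩ := List.mem_map.1 hm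
      exact hnew y hy hyi
    · rw [List.pairwise_append] at ho ⊢
      refine ⟨ho.1, List.pairwise_cons.2 ⟨?_, ho.2.1⟩, ?_⟩
      · rintro z hz ⟨j, r, hj, hjw, -⟩
        have := hBt z hz j r hj
        change j < w.index at hjw
        omega
      · intro a ha c hc
        rcases List.mem_cons.1 hc with rfl | hc
        · exact hS a (by simp [ha])
        · exact ho.2.2 a ha c hc
    · have hwA : Entry.enq w ∉ A ++ .enq e :: B := fun hm => hnew _ hm rfl
      have hmono : ∀ {y z : Entry P V}, y ≠ .enq w → (∀ x ∈ Q₁ ++ e :: Q₂, y = .enq x →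
          ∀ j r, TerminatesAt σ z.index j r → x.time ≤ j) → ∀ x ∈ Q₁ ++ w :: e :: Q₂, y = .enq x →
          ∀ j r, TerminatesAt σ z.index j r → x.time ≤ j := by
        intro y z hy H x hx hyx
        rcases List.mem_cons.1 (hpQ.subset hx) with rfl | hx
        · exact absurd hyx hy
        · exact H x hx hyx
      rw [List.pairwise_append] at hl ⊢
      refine ⟨hl.1.imp_of_mem fun {y z} hy _ => hmono ?_, List.pairwise_cons.2 ⟨?_,
        hl.2.1.imp_of_mem fun {y z} hy _ => hmono ?_⟩, ?_⟩
      · rintro rfl; exact hwA (by simp [hy])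
      · rintro z hz x - hx j r hj
        cases hx
        exact hBt z hz j r hj
      · rintro rfl; exact hwA (List.mem_append_right _ hy)
      · intro a ha c hc
        rcases List.mem_cons.1 hc with rfl | hc
        · rintro x hx rfl j r hj
          rcases List.mem_cons.1 (hpQ.subset hx) with rfl | hx
          · exact absurd (by simp [ha]) hwA
          · exact hQ x hx j r hj
        · exact hmono (by rintro rfl; exact hwA (by simp [ha])) (hl.2.2 a ha c hc)
  · push Not at hex
    have hlt : ∀ x ∈ Q, x.loc < w.loc := fun x hx => lt_of_le_of_ne (hex x hx) (hloc x hx)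
    refine ⟨S ++ [.enq w], Q ++ [w], ⟨h.runs.append (.enq _ (.nil _)), ?_, ?_, ?_, ?_⟩,
      List.perm_append_singleton _ _, List.perm_append_singleton _ _⟩
    · simp only [List.pairwise_append, h.sorted, List.pairwise_singleton, List.mem_singleton,
        forall_eq, true_and]
      exact hlt
    · rw [List.map_append, List.nodup_append]
      refine ⟨h.nodup, by simp, ?_⟩
      rintro _ ha _ hb
      obtain ⟨y, hy, rfl⟩ := List.mem_map.1 ha
      simp only [List.map_cons, List.map_nil, List.mem_singleton] at hb
      subst hb
      exact hnew y hy
    · simp only [List.pairwise_append, h.order, List.pairwise_singleton, List.mem_singleton,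
        forall_eq, true_and]
      exact hS
    · simp only [List.pairwise_append, List.pairwise_singleton, List.mem_singleton,
        forall_eq, true_and]
      refine ⟨h.later.imp_of_mem ?_, ?_⟩
      · rintro y z hy - H x hx rfl
        rcases List.mem_append.1 hx with hx | hx
        · exact H x hx rfl
        · rw [List.mem_singleton] at hx
          subst hx
          exact absurd rfl (hnew _ hy)
      · rintro y hy x hx rfl j r hj
        rcases List.mem_append.1 hx with hx | hx
        · exact hQ x hx j r hj
        · rw [List.mem_singleton] at hx
          subst hx
          exact absurd rfl (hnew _ hy)

/-- All enqueues of a list `N` of tickets are inserted, in the order of their locations. -/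
theorem Witness.insert_list (h : Witness σ S Q) (N : List (Ticket P V))
    (hN : N.Pairwise (fun x y => x.loc < y.loc ∧ x.time ≤ y.time ∧ x.index ≠ y.index))
    (hnew : ∀ w ∈ N, ∀ y ∈ S, y.index ≠ w.index)
    (hloc : ∀ w ∈ N, ∀ x ∈ Q, x.loc ≠ w.loc)
    (htime : ∀ w ∈ N, ∀ x ∈ Q, w.loc < x.loc → w.time ≤ x.time)
    (hw : ∀ w ∈ N, w.index < w.time)
    (htermN : ∀ x ∈ N, ∀ j r, TerminatesAt σ x.index j r → x.time ≤ j)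
    (htermQ : ∀ x ∈ Q, ∀ j r, TerminatesAt σ x.index j r → x.time ≤ j)
    (hS : ∀ w ∈ N, ∀ y ∈ S, ¬ AppearsBefore σ w.index y.index)
    (hQ : ∀ w ∈ N, ∀ x ∈ Q, ∀ j r, TerminatesAt σ w.index j r → x.time ≤ j) :
    ∃ S' Q', Witness σ S' Q' ∧ S'.Perm (N.map .enq ++ S) ∧ Q'.Perm (N ++ Q) := by
  induction N generalizing S Q with
  | nil => exact ⟨S, Q, h, .refl _, .refl _⟩
  | cons w N ih =>
    simp only [List.mem_cons, forall_eq_or_imp, List.pairwise_cons]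
      at hN hnew hloc htime hw htermN hS hQ
    obtain ⟨S₁, Q₁, h₁, hpS, hpQ⟩ := h.insert w hnew.1 hloc.1 htime.1 hw.1 htermQ hS.1 hQ.1
    have hmS : ∀ y, y ∈ S₁ ↔ y = .enq w ∨ y ∈ S := fun y => by rw [hpS.mem_iff, List.mem_cons]
    have hmQ : ∀ y, y ∈ Q₁ ↔ y = w ∨ y ∈ Q := fun y => by rw [hpQ.mem_iff, List.mem_cons]
    obtain ⟨S₂, Q₂, h₂, hpS₂, hpQ₂⟩ := ih (S := S₁) (Q := Q₁) h₁ hN.2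
      (by
        simp only [hmS, forall_eq_or_imp]
        exact fun a ha => ⟨(hN.1 a ha).2.2, hnew.2 a ha⟩)
      (by
        simp only [hmQ, forall_eq_or_imp]
        exact fun a ha => ⟨(hN.1 a ha).1.ne, hloc.2 a ha⟩)
      (by
        simp only [hmQ, forall_eq_or_imp]
        exact fun a ha => ⟨fun hlt => absurd hlt (hN.1 a ha).1.asymm, htime.2 a ha⟩)
      hw.2 htermN.2
      (by simp only [hmQ, forall_eq_or_imp]; exact ⟨htermN.1, htermQ⟩)
      (by
        simp only [hmS, forall_eq_or_imp]
        refine fun a ha => ⟨?_, hS.2 a ha⟩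
        rintro ⟨j, r, hj, hjw, -⟩
        have h1 := htermN.2 a ha j r hj
        have h2 := (hN.1 a ha).2.1
        have h3 := hw.1
        change j < w.index at hjw
        omega)
      (by
        simp only [hmQ, forall_eq_or_imp]
        exact fun a ha => ⟨fun j r hj => (hN.1 a ha).2.1.trans (htermN.2 a ha j r hj), hQ.2 a ha⟩)
    refine ⟨S₂, Q₂, h₂, hpS₂.trans ?_, hpQ₂.trans ?_⟩
    · exact ((List.Perm.refl _).append hpS).trans List.perm_middle
    · exact ((List.Perm.refl _).append hpQ).trans List.perm_middle

/-- A dequeue that has not terminated can be appended at the end. -/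
theorem Witness.append_deq (h : Witness σ S Q) (i : ℕ) (x : Option (Ticket P V))
    {Q' : List (Ticket P V)} (hrun : Runs Q [.deq i x] Q') (hsub : Q'.Sublist Q)
    (hnew : ∀ y ∈ S, y.index ≠ i) (hi : ∀ j r, ¬ TerminatesAt σ i j r) :
    Witness σ (S ++ [.deq i x]) Q' where
  runs := h.runs.append hrun
  sorted := h.sorted.sublist hsub
  nodup := by
    rw [List.map_append, List.nodup_append]
    refine ⟨h.nodup, by simp, ?_⟩
    rintro _ ha _ hb
    obtain ⟨y, hy, rfl⟩ := List.mem_map.1 ha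
    simp only [List.map_cons, List.map_nil, List.mem_singleton] at hb
    subst hb
    exact hnew y hy
  order := by
    simp only [List.pairwise_append, h.order, List.pairwise_singleton, List.mem_singleton,
      forall_eq, true_and]
    rintro y hy ⟨j, r, hj, -⟩
    exact hi j r hj
  later := by
    simp only [List.pairwise_append, List.pairwise_singleton, List.mem_singleton,
      forall_eq, true_and]
    refine ⟨h.later.imp fun H x hx => H x (hsub.subset hx), ?_⟩
    rintro y hy x - - j r hj
    exact absurd hj (hi j r)

end Witness

/-! ### Histories that grow by one event -/

/-- The operation invoked at position `i` by the thread `t` has not terminated in `σ`, and `t` has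
not done anything since. -/
def Pending {P V : Type*} (σ : List (Event P V)) (t : Thread P) (i : ℕ) : Prop :=
  (∃ op, σ[i]? = some (.inv t op)) ∧ ∀ k e, i < k → σ[k]? = some e → e.thread ≠ t

theorem getElem?_append_of_eq_some {α : Type*} {l : List α} {i : ℕ} {a : α} (h : l[i]? = some a)
    (l' : List α) : (l ++ l')[i]? = some a := by
  rw [List.getElem?_append_left (List.getElem?_eq_some_iff.1 h).1, h]

section History

variable {P V : Type*} {σ : List (Event P V)} {e : Event P V} {t : Thread P} {i j k : ℕ}
  {r : Response V}

theorem Pending.lt_length (h : Pending σ t i) : i < σ.length := by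
  obtain ⟨⟨op, h⟩, -⟩ := h
  exact (List.getElem?_eq_some_iff.1 h).1

theorem Pending.not_terminatesAt (h : Pending σ t i) : ¬ TerminatesAt σ i j r := by
  rintro ⟨t', op, hi, hij, hj, -⟩
  obtain ⟨⟨op', h'⟩, h⟩ := h
  rw [h'] at hi
  cases hi
  exact h j _ hij hj rfl

theorem Pending.append (h : Pending σ t i) (he : e.thread ≠ t) : Pending (σ ++ [e]) t i := by
  obtain ⟨⟨op, h'⟩, h⟩ := h
  refine ⟨⟨op, getElem?_append_of_eq_some h' _⟩, fun k e' hk hke => ?_⟩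
  rw [List.getElem?_append] at hke
  split_ifs at hke with hlt
  · exact h k e' hk hke
  · rw [List.getElem?_singleton] at hke
    split_ifs at hke
    cases hke
    exact he

theorem Pending.eq_of_pending (h : Pending σ t i) (h' : Pending σ t j) : i = j := by
  obtain ⟨⟨op, hi⟩, h⟩ := h
  obtain ⟨⟨op', hj⟩, h'⟩ := h'
  rcases lt_trichotomy i j with hij | rfl | hij
  · exact absurd rfl (h j _ hij hj)
  · rfl
  · exact absurd rfl (h' i _ hij hi)

theorem pending_append_inv (σ : List (Event P V)) (t : Thread P) (op : Operation V) :
    Pending (σ ++ [.inv t op]) t σ.length := by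
  refine ⟨⟨op, by simp⟩, fun k e hk hke => ?_⟩
  have := (List.getElem?_eq_some_iff.1 hke).1
  simp only [List.length_append, List.length_singleton] at this
  omega

theorem TerminatesAt.of_append (h : TerminatesAt (σ ++ [e]) i j r) :
    TerminatesAt σ i j r ∨ j = σ.length ∧ ∃ t, e = .res t r ∧ Pending σ t i := by
  obtain ⟨t, op, hi, hij, hj, hk⟩ := h
  have hk' : ∀ k e', i < k → k < j → σ[k]? = some e' → e'.thread ≠ t := fun k e' h1 h2 h3 =>
    hk k e' h1 h2 (getElem?_append_of_eq_some h3 _)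
  have hjl := (List.getElem?_eq_some_iff.1 hj).1
  simp only [List.length_append, List.length_singleton] at hjl
  rw [List.getElem?_append_left (by omega)] at hi
  by_cases hlt : j < σ.length
  · rw [List.getElem?_append_left hlt] at hj
    exact .inl ⟨t, op, hi, hij, hj, hk'⟩
  · obtain rfl : j = σ.length := by omega
    simp only [List.getElem?_append_right le_rfl, Nat.sub_self, List.getElem?_cons_zero,
      Option.some.injEq] at hj
    exact .inr ⟨rfl, t, hj, ⟨op, hi⟩, fun k e' h1 h2 =>
      hk' k e' h1 (List.getElem?_eq_some_iff.1 h2).1 h2⟩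

theorem AppearsBefore.of_append (h : AppearsBefore (σ ++ [e]) i k) (hk : k < σ.length) :
    AppearsBefore σ i k := by
  obtain ⟨j, r, hj, hjk, op, t, ht⟩ := h
  rw [List.getElem?_append_left hk] at ht
  rcases hj.of_append with hj | ⟨rfl, -⟩
  · exact ⟨j, r, hj, hjk, op, t, ht⟩
  · omega

theorem Witness.append_event {S : List (Entry P V)} {Q : List (Ticket P V)} (h : Witness σ S Q)
    (hS : ∀ y ∈ S, y.index < σ.length) (hQ : ∀ x ∈ Q, x.time ≤ σ.length) (e : Event P V) :
    Witness (σ ++ [e]) S Q where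
  runs := h.runs
  sorted := h.sorted
  nodup := h.nodup
  order := h.order.imp_of_mem fun hy _ H H' => H (H'.of_append (hS _ hy))
  later := h.later.imp fun H x hx hy j r hj => by
    rcases hj.of_append with hj | ⟨rfl, -⟩
    · exact H x hx hy j r hj
    · exact hQ x hx

end History

/-! ### The abstract queue: an unbounded array of cells -/

/-- The status of a producer: no operation; invoked at position `i` and without a location so far;
or with a ticket `x`, before and after the store of the data, and after the store of the flag. -/
inductive ProdStatus (P V : Type*) where
  | idle
  | called (i : ℕ) (v : V)
  | placed (x : Ticket P V)
  | stored (x : Ticket P V)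
  | finished (x : Ticket P V)

/-- The status of the consumer: no operation; a dequeue invoked at position `i` that is not
linearized yet; or one that is linearized with response `r`. -/
inductive ConsStatus (V : Type*) where
  | idle
  | active (i : ℕ)
  | finished (i : ℕ) (r : Response V)

/-- The queue as an unbounded array of cells, one for each location, together with the history and
a linearization `seq` which leaves the queue content `queue`. It takes into account what happened
up to the latest snapshot, when the history had length `snap`, and since then the linearized
dequeue, if any. The elements that have been set since the snapshot, listed in `fresh`, are not
in `seq`. -/
structure Abs (P V : Type*) where
  hist : List (Event P V)
  tail : ℕ
  cell : ℕ → Node V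
  tickets : Set (Ticket P V)
  seq : List (Entry P V)
  queue : List (Ticket P V)
  fresh : List (Ticket P V)
  snap : ℕ
  prod : P → ProdStatus P V
  cons : ConsStatus V

/-- What the status of a producer `t` means. -/
def ProdStatus.Valid {P V : Type*} (σ : List (Event P V)) (tickets : Set (Ticket P V))
    (cell : ℕ → Node V) (t : P) : ProdStatus P V → Prop
  | .idle => True
  | .called i v => Pending σ (.producer t) i ∧
      σ[i]? = some (.inv (.producer t) (.enqueue v)) ∧ ∀ x ∈ tickets, x.index ≠ i
  | .placed x => x ∈ tickets ∧ x.thread = t ∧ Pending σ (.producer t) x.index ∧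
      (cell x.loc).isSet = .empty
  | .stored x => x ∈ tickets ∧ x.thread = t ∧ Pending σ (.producer t) x.index ∧
      (cell x.loc).isSet = .empty ∧ (cell x.loc).data = some x.val
  | .finished x => x ∈ tickets ∧ x.thread = t ∧ Pending σ (.producer t) x.index ∧
      (cell x.loc).isSet ≠ .empty

/-- What the status of the consumer means. -/
def ConsStatus.Valid {P V : Type*} (σ : List (Event P V)) (S : List (Entry P V)) :
    ConsStatus V → Prop
  | .idle => True
  | .active i => Pending σ .consumer i ∧ σ[i]? = some (.inv .consumer .dequeue) ∧
      ∀ y ∈ S, y.index ≠ i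
  | .finished i r => Pending σ .consumer i ∧ ∃ x, .deq i x ∈ S ∧ (Entry.deq i x).response = r

/-- The invariant of the abstract queue. -/
structure Abs.Inv {P V : Type*} (A : Abs P V) : Prop where
  witness : Witness A.hist A.seq A.queue
  snap_le : A.snap ≤ A.hist.length
  seq_lt : ∀ y ∈ A.seq, y.index < A.snap
  queue_time : ∀ x ∈ A.queue, x.time ≤ A.snap
  deq_hist : ∀ i x, .deq i x ∈ A.seq → A.hist[i]? = some (.inv .consumer .dequeue)
  deq_term : ∀ i x, .deq i x ∈ A.seq → ∀ j r, TerminatesAt A.hist i j r →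
    (Entry.deq i x).response = r
  enq_mem : ∀ x, .enq x ∈ A.seq → x ∈ A.tickets ∧ (A.cell x.loc).isSet ≠ .empty ∧ x ∉ A.fresh
  loc_lt : ∀ x ∈ A.tickets, x.loc < A.tail
  ticket_hist : ∀ x ∈ A.tickets,
    A.hist[x.index]? = some (.inv (.producer x.thread) (.enqueue x.val))
  ticket_time : ∀ x ∈ A.tickets, x.index < x.time ∧ x.time ≤ A.hist.length
  loc_inj : ∀ x ∈ A.tickets, ∀ y ∈ A.tickets, x.loc = y.loc → x = y
  index_inj : ∀ x ∈ A.tickets, ∀ y ∈ A.tickets, x.index = y.index → x = y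
  time_mono : ∀ x ∈ A.tickets, ∀ y ∈ A.tickets, x.loc < y.loc → x.time ≤ y.time
  ticket_term : ∀ x ∈ A.tickets, ∀ j r, TerminatesAt A.hist x.index j r →
    (A.cell x.loc).isSet ≠ .empty ∧ r = .done ∧ x.time ≤ j
  fresh_term : ∀ x ∈ A.fresh, ∀ j r, TerminatesAt A.hist x.index j r → A.snap ≤ j
  fresh_mem : ∀ x ∈ A.fresh, x ∈ A.tickets
  fresh_nodup : A.fresh.Nodup
  set_iff : ∀ l, (A.cell l).isSet = .set ↔ ∃ x, (x ∈ A.queue ∨ x ∈ A.fresh) ∧ x.loc = l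
  nonempty : ∀ x ∈ A.tickets, (A.cell x.loc).isSet ≠ .empty →
    (A.cell x.loc).data = some x.val ∧ (.enq x ∈ A.seq ∨ x ∈ A.fresh)
  lt_tail : ∀ l, (A.cell l).isSet ≠ .empty → l < A.tail
  term : ∀ i j r, TerminatesAt A.hist i j r →
    (∃ x ∈ A.tickets, x.index = i) ∨ ∃ y ∈ A.seq, y.index = i
  prod : ∀ t, (A.prod t).Valid A.hist A.tickets A.cell t
  cons : A.cons.Valid A.hist A.seq

section Abs

variable {P V : Type*} {A : Abs P V} {e : Event P V} {σ : List (Event P V)}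

theorem ProdStatus.Valid.append {tk : Set (Ticket P V)} {cell : ℕ → Node V} {t : P} :
    ∀ {st : ProdStatus P V}, st.Valid σ tk cell t → e.thread ≠ .producer t →
      st.Valid (σ ++ [e]) tk cell t
  | .idle, h, _ => h
  | .called _ _, h, he => ⟨h.1.append he, getElem?_append_of_eq_some h.2.1 _, h.2.2⟩
  | .placed _, h, he => ⟨h.1, h.2.1, h.2.2.1.append he, h.2.2.2⟩
  | .stored _, h, he => ⟨h.1, h.2.1, h.2.2.1.append he, h.2.2.2⟩
  | .finished _, h, he => ⟨h.1, h.2.1, h.2.2.1.append he, h.2.2.2⟩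

theorem ConsStatus.Valid.append {S : List (Entry P V)} :
    ∀ {st : ConsStatus V}, st.Valid σ S → e.thread ≠ .consumer → st.Valid (σ ++ [e]) S
  | .idle, h, _ => h
  | .active _, h, he => ⟨h.1.append he, getElem?_append_of_eq_some h.2.1 _, h.2.2⟩
  | .finished _ _, h, he => ⟨h.1.append he, h.2⟩

/-- The status of a producer stays valid when other producers obtain tickets and when the cells of
others change. -/
theorem ProdStatus.Valid.mono {tk tk' : Set (Ticket P V)} {cell cell' : ℕ → Node V} {t : P}
    (hsub : tk ⊆ tk') (hnew : ∀ x ∈ tk', x ∉ tk → ∀ i, Pending σ (.producer t) i → x.index ≠ i)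
    (hcell : ∀ x ∈ tk, x.thread = t → (cell' x.loc) = (cell x.loc)) :
    ∀ {st : ProdStatus P V}, st.Valid σ tk cell t → st.Valid σ tk' cell' t
  | .idle, h => h
  | .called i _, h => ⟨h.1, h.2.1, fun x hx => by
      by_cases hx' : x ∈ tk
      · exact h.2.2 x hx'
      · exact hnew x hx hx' i h.1⟩
  | .placed x, h => ⟨hsub h.1, h.2.1, h.2.2.1, by rw [hcell x h.1 h.2.1]; exact h.2.2.2⟩
  | .stored x, h => ⟨hsub h.1, h.2.1, h.2.2.1, by rw [hcell x h.1 h.2.1]; exact h.2.2.2⟩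
  | .finished x, h => ⟨hsub h.1, h.2.1, h.2.2.1, by rw [hcell x h.1 h.2.1]; exact h.2.2.2⟩

theorem Abs.Inv.queue_mem (h : A.Inv) {x : Ticket P V} (hx : x ∈ A.queue) :
    x ∈ A.tickets ∧ (A.cell x.loc).isSet ≠ .empty ∧ x ∉ A.fresh :=
  h.enq_mem x (h.witness.enq_mem hx)

theorem Abs.Inv.queue_set (h : A.Inv) {x : Ticket P V} (hx : x ∈ A.queue) :
    (A.cell x.loc).isSet = .set :=
  (h.set_iff _).2 ⟨x, .inl hx, rfl⟩

/-- An event is appended to the history. If it is the termination of an operation, then this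
operation has had its effect before. -/
theorem Abs.Inv.append_event (h : A.Inv) (e : Event P V) (prod : P → ProdStatus P V)
    (cons : ConsStatus V)
    (hterm : ∀ i t r, e = .res t r → Pending A.hist t i →
      (∀ x ∈ A.tickets, x.index = i → (A.cell x.loc).isSet ≠ .empty ∧ r = .done) ∧
      (∀ x, .deq i x ∈ A.seq → (Entry.deq i x).response = r) ∧
      ((∃ x ∈ A.tickets, x.index = i) ∨ ∃ y ∈ A.seq, y.index = i))
    (hprod : ∀ t, (prod t).Valid (A.hist ++ [e]) A.tickets A.cell t)
    (hcons : cons.Valid (A.hist ++ [e]) A.seq) :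
    ({ A with hist := A.hist ++ [e], prod := prod, cons := cons } : Abs P V).Inv where
  witness := h.witness.append_event (fun y hy => (h.seq_lt y hy).trans_le h.snap_le)
    (fun x hx => (h.queue_time x hx).trans h.snap_le) e
  snap_le := by simpa using h.snap_le.trans (Nat.le_succ _)
  seq_lt := h.seq_lt
  queue_time := h.queue_time
  deq_hist i x hx := getElem?_append_of_eq_some (h.deq_hist i x hx) _
  deq_term i x hx j r hj := by
    rcases hj.of_append with hj | ⟨rfl, t, he, hp⟩
    · exact h.deq_term i x hx j r hj
    · exact (hterm i t r he hp).2.1 x hx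
  enq_mem := h.enq_mem
  loc_lt := h.loc_lt
  ticket_hist x hx := getElem?_append_of_eq_some (h.ticket_hist x hx) _
  ticket_time x hx := ⟨(h.ticket_time x hx).1, by
    simpa using (h.ticket_time x hx).2.trans (Nat.le_succ _)⟩
  loc_inj := h.loc_inj
  index_inj := h.index_inj
  time_mono := h.time_mono
  ticket_term x hx j r hj := by
    rcases hj.of_append with hj | ⟨rfl, t, he, hp⟩
    · exact h.ticket_term x hx j r hj
    · have := (hterm _ t r he hp).1 x hx rfl
      exact ⟨this.1, this.2, (h.ticket_time x hx).2⟩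
  fresh_term x hx j r hj := by
    rcases hj.of_append with hj | ⟨rfl, -⟩
    · exact h.fresh_term x hx j r hj
    · exact h.snap_le
  fresh_mem := h.fresh_mem
  fresh_nodup := h.fresh_nodup
  set_iff := h.set_iff
  nonempty := h.nonempty
  lt_tail := h.lt_tail
  term i j r hj := by
    rcases hj.of_append with hj | ⟨rfl, t, he, hp⟩
    · exact h.term i j r hj
    · exact (hterm i t r he hp).2.2
  prod := hprod
  cons := hcons

theorem forall_update_valid [DecidableEq P] {prod : P → ProdStatus P V} {t : P}
    {st : ProdStatus P V} {p : P → ProdStatus P V → Prop} (h : p t st)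
    (h' : ∀ u, u ≠ t → p u (prod u)) (u : P) : p u (Function.update prod t st u) := by
  by_cases hu : u = t
  · subst hu; simpa using h
  · simpa [hu] using h' u hu

theorem Abs.Inv.enqInvoke [DecidableEq P] (h : A.Inv) (t : P) (v : V) :
    ({ A with
      hist := A.hist ++ [.inv (.producer t) (.enqueue v)]
      prod := Function.update A.prod t (.called A.hist.length v) } : Abs P V).Inv := by
  refine h.append_event _ _ _ (by simp) (forall_update_valid (p := fun u st =>
    st.Valid (A.hist ++ [.inv (.producer t) (.enqueue v)]) A.tickets A.cell u) ?_ ?_) ?_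
  · refine ⟨pending_append_inv _ _ _, by simp, fun x hx => ?_⟩
    have := h.ticket_time x hx
    omega
  · intro u hu
    exact (h.prod u).append (by simpa [Event.thread] using hu.symm)
  · exact h.cons.append (by simp [Event.thread])

theorem Abs.Inv.enqReturn [DecidableEq P] (h : A.Inv) (t : P) (x : Ticket P V)
    (hx : A.prod t = .finished x) :
    ({ A with
      hist := A.hist ++ [.res (.producer t) .done]
      prod := Function.update A.prod t .idle } : Abs P V).Inv := by
  have hv := h.prod t
  rw [hx] at hv
  obtain ⟨hxt, rfl, hp, hne⟩ := hv
  refine h.append_event _ _ _ ?_ (forall_update_valid (p := fun u st =>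
    st.Valid (A.hist ++ [.res (.producer x.thread) .done]) A.tickets A.cell u) (by trivial) ?_) ?_
  · intro i t r he hi
    cases he
    obtain rfl := hp.eq_of_pending hi
    refine ⟨fun y hy hyx => ?_, fun y hy => ?_, .inl ⟨x, hxt, rfl⟩⟩
    · obtain rfl := h.index_inj y hy x hxt hyx
      exact ⟨hne, rfl⟩
    · have h1 := h.deq_hist _ y hy
      rw [h.ticket_hist x hxt] at h1
      simp at h1
  · intro u hu
    exact (h.prod u).append (by simpa [Event.thread] using hu.symm)
  · exact h.cons.append (by simp [Event.thread])

theorem Abs.Inv.deqInvoke (h : A.Inv) :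
    ({ A with
      hist := A.hist ++ [.inv .consumer .dequeue]
      cons := .active A.hist.length } : Abs P V).Inv := by
  refine h.append_event _ _ _ (by simp) (fun u => (h.prod u).append (by simp [Event.thread])) ?_
  refine ⟨pending_append_inv _ _ _, by simp, fun y hy => ?_⟩
  exact ((h.seq_lt y hy).trans_le h.snap_le).ne

theorem Abs.Inv.deqReturn (h : A.Inv) (i : ℕ) (r : Response V) (hc : A.cons = .finished i r) :
    ({ A with hist := A.hist ++ [.res .consumer r], cons := .idle } : Abs P V).Inv := by
  have hv := h.cons
  rw [hc] at hv
  obtain ⟨hp, x, hx, rfl⟩ := hv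
  refine h.append_event _ _ _ ?_ (fun u => (h.prod u).append (by simp [Event.thread])) trivial
  intro i' t r he hi
  cases he
  obtain rfl := hp.eq_of_pending hi
  refine ⟨fun y hy hyx => ?_, fun y hy => ?_, .inr ⟨_, hx, rfl⟩⟩
  · have h1 := h.deq_hist _ x hx
    rw [← hyx, h.ticket_hist y hy] at h1
    simp at h1
  · have := List.inj_on_of_nodup_map h.witness.nodup hy hx rfl
    rw [this]

theorem Abs.Inv.fetchAdd [DecidableEq P] (h : A.Inv) (t : P) (i : ℕ) (v : V)
    (hst : A.prod t = .called i v) :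
    ({ A with
      tail := A.tail + 1
      tickets := insert ⟨t, v, i, A.tail, A.hist.length⟩ A.tickets
      prod := Function.update A.prod t (.placed ⟨t, v, i, A.tail, A.hist.length⟩) } :
        Abs P V).Inv := by
  have hv := h.prod t
  rw [hst] at hv
  obtain ⟨hp, hi, hnew⟩ := hv
  have hempty : (A.cell A.tail).isSet = .empty := by
    by_contra hc
    exact lt_irrefl _ (h.lt_tail _ hc)
  set x : Ticket P V := ⟨t, v, i, A.tail, A.hist.length⟩ with hx
  exact {
    witness := h.witness
    snap_le := h.snap_le
    seq_lt := h.seq_lt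
    queue_time := h.queue_time
    deq_hist := h.deq_hist
    deq_term := h.deq_term
    enq_mem := fun y hy => ⟨Set.mem_insert_of_mem _ (h.enq_mem y hy).1, (h.enq_mem y hy).2⟩
    loc_lt := by
      rintro y (rfl | hy)
      · exact Nat.lt_succ_self _
      · exact (h.loc_lt y hy).trans (Nat.lt_succ_self _)
    ticket_hist := by
      rintro y (rfl | hy)
      · exact hi
      · exact h.ticket_hist y hy
    ticket_time := by
      rintro y (rfl | hy)
      · exact ⟨hp.lt_length, le_rfl⟩
      · exact h.ticket_time y hy
    loc_inj := by
      rintro y (rfl | hy) z (rfl | hz) hyz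
      · rfl
      · exact absurd hyz (h.loc_lt z hz).ne'
      · exact absurd hyz (h.loc_lt y hy).ne
      · exact h.loc_inj y hy z hz hyz
    index_inj := by
      rintro y (rfl | hy) z (rfl | hz) hyz
      · rfl
      · exact absurd hyz.symm (hnew z hz)
      · exact absurd hyz (hnew y hy)
      · exact h.index_inj y hy z hz hyz
    time_mono := by
      rintro y (rfl | hy) z (rfl | hz) hyz
      · exact le_rfl
      · exact absurd hyz (h.loc_lt z hz).asymm
      · exact (h.ticket_time y hy).2
      · exact h.time_mono y hy z hz hyz
    ticket_term := by
      rintro y (rfl | hy) j r hj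
      · exact absurd hj hp.not_terminatesAt
      · exact h.ticket_term y hy j r hj
    fresh_term := h.fresh_term
    fresh_mem := fun y hy => Set.mem_insert_of_mem _ (h.fresh_mem y hy)
    fresh_nodup := h.fresh_nodup
    set_iff := h.set_iff
    nonempty := by
      rintro y (rfl | hy) hne
      · exact absurd hempty hne
      · exact h.nonempty y hy hne
    lt_tail := fun l hl => (h.lt_tail l hl).trans (Nat.lt_succ_self _)
    term := fun i j r hj => (h.term i j r hj).imp
      (fun ⟨y, hy, hyi⟩ => ⟨y, Set.mem_insert_of_mem _ hy, hyi⟩) id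
    prod := by
      refine forall_update_valid (p := fun u st => st.Valid A.hist (insert x A.tickets) A.cell u)
        ⟨Set.mem_insert _ _, rfl, hp, hempty⟩ fun u hu => ?_
      refine (h.prod u).mono (Set.subset_insert _ _) ?_ fun _ _ _ => rfl
      rintro y (rfl | hy) hy' k hk rfl
      · obtain ⟨⟨op, hk⟩, -⟩ := hk
        change A.hist[i]? = _ at hk
        rw [hi] at hk
        cases hk
        exact hu rfl
      · exact hy' hy
    cons := h.cons }

theorem Abs.Inv.thread_ne (h : A.Inv) {x y : Ticket P V} (hx : x ∈ A.tickets) (hy : y ∈ A.tickets)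
    (hxy : y.thread ≠ x.thread) : y.loc ≠ x.loc := by
  intro hl
  rw [h.loc_inj y hy x hx hl] at hxy
  exact hxy rfl

theorem Abs.Inv.storeData [DecidableEq P] (h : A.Inv) (t : P) (x : Ticket P V)
    (hst : A.prod t = .placed x) :
    ({ A with
      cell := Function.update A.cell x.loc { A.cell x.loc with data := some x.val }
      prod := Function.update A.prod t (.stored x) } : Abs P V).Inv := by
  have hv := h.prod t
  rw [hst] at hv
  obtain ⟨hxt, rfl, hp, hempty⟩ := hv
  set cell' := Function.update A.cell x.loc { A.cell x.loc with data := some x.val } with hcell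
  have hself : cell' x.loc = { A.cell x.loc with data := some x.val } := by simp [hcell]
  have hflag : ∀ l, (cell' l).isSet = (A.cell l).isSet := by
    intro l
    by_cases hl : l = x.loc
    · subst hl; rw [hself]
    · simp [hcell, hl]
  exact {
    witness := h.witness
    snap_le := h.snap_le
    seq_lt := h.seq_lt
    queue_time := h.queue_time
    deq_hist := h.deq_hist
    deq_term := h.deq_term
    enq_mem := fun y hy => by simpa only [hflag] using h.enq_mem y hy
    loc_lt := h.loc_lt
    ticket_hist := h.ticket_hist
    ticket_time := h.ticket_time
    loc_inj := h.loc_inj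
    index_inj := h.index_inj
    time_mono := h.time_mono
    ticket_term := by simpa only [hflag] using h.ticket_term
    fresh_term := h.fresh_term
    fresh_mem := h.fresh_mem
    fresh_nodup := h.fresh_nodup
    set_iff := by simpa only [hflag] using h.set_iff
    nonempty := by
      simp only [hflag]
      intro y hy hne
      refine ⟨?_, (h.nonempty y hy hne).2⟩
      have hl : y.loc ≠ x.loc := by
        intro hl
        rw [hl] at hne
        exact hne hempty
      simpa [hcell, hl] using (h.nonempty y hy hne).1
    lt_tail := by simpa only [hflag] using h.lt_tail
    term := h.term
    prod := by
      refine forall_update_valid (p := fun u st => st.Valid A.hist A.tickets cell' u)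
        ⟨hxt, rfl, hp, by rw [hself]; exact hempty, by rw [hself]⟩ fun u hu => ?_
      refine (h.prod u).mono subset_rfl (fun y hy hy' => absurd hy hy') ?_
      rintro y hy rfl
      simp [hcell, h.thread_ne hxt hy hu]
    cons := h.cons }

theorem Abs.Inv.storeSet [DecidableEq P] (h : A.Inv) (t : P) (x : Ticket P V)
    (hst : A.prod t = .stored x) :
    ({ A with
      cell := Function.update A.cell x.loc { A.cell x.loc with isSet := .set }
      fresh := x :: A.fresh
      prod := Function.update A.prod t (.finished x) } : Abs P V).Inv := by
  have hv := h.prod t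
  rw [hst] at hv
  obtain ⟨hxt, rfl, hp, hempty, hdata⟩ := hv
  set cell' := Function.update A.cell x.loc { A.cell x.loc with isSet := .set } with hcell
  have hself : cell' x.loc = { A.cell x.loc with isSet := .set } := by simp [hcell]
  have hother : ∀ l, l ≠ x.loc → cell' l = A.cell l := fun l hl => by simp [hcell, hl]
  have hne : ∀ l, (A.cell l).isSet ≠ .empty → (cell' l).isSet ≠ .empty := by
    intro l
    by_cases hl : l = x.loc
    · subst hl; rw [hself]; simp
    · rw [hother l hl]; exact id
  have hxf : x ∉ A.fresh := by
    intro hx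
    have := (h.set_iff x.loc).2 ⟨x, .inr hx, rfl⟩
    rw [hempty] at this
    cases this
  exact {
    witness := h.witness
    snap_le := h.snap_le
    seq_lt := h.seq_lt
    queue_time := h.queue_time
    deq_hist := h.deq_hist
    deq_term := h.deq_term
    enq_mem := fun y hy => by
      obtain ⟨h1, h2, h3⟩ := h.enq_mem y hy
      refine ⟨h1, hne _ h2, ?_⟩
      rw [List.mem_cons, not_or]
      refine ⟨?_, h3⟩
      rintro rfl
      exact h2 hempty
    loc_lt := h.loc_lt
    ticket_hist := h.ticket_hist
    ticket_time := h.ticket_time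
    loc_inj := h.loc_inj
    index_inj := h.index_inj
    time_mono := h.time_mono
    ticket_term := fun y hy j r hj =>
      ⟨hne _ (h.ticket_term y hy j r hj).1, (h.ticket_term y hy j r hj).2⟩
    fresh_term := by
      intro y hy j r hj
      rcases List.mem_cons.1 hy with rfl | hy
      · exact absurd hj hp.not_terminatesAt
      · exact h.fresh_term y hy j r hj
    fresh_mem := by
      intro y hy
      rcases List.mem_cons.1 hy with rfl | hy
      · exact hxt
      · exact h.fresh_mem y hy
    fresh_nodup := List.nodup_cons.2 ⟨hxf, h.fresh_nodup⟩
    set_iff := by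
      intro l
      by_cases hl : l = x.loc
      · subst hl
        change (cell' x.loc).isSet = _ ↔ _
        rw [hself]
        simp only [true_iff]
        exact ⟨x, .inr (by simp), rfl⟩
      · change (cell' l).isSet = _ ↔ _
        rw [hother l hl, h.set_iff l]
        simp only [List.mem_cons]
        constructor
        · rintro ⟨y, hy, hyl⟩
          exact ⟨y, hy.imp id .inr, hyl⟩
        · rintro ⟨y, hy | rfl | hy, hyl⟩
          · exact ⟨y, .inl hy, hyl⟩
          · exact absurd hyl.symm hl
          · exact ⟨y, .inr hy, hyl⟩
    nonempty := by
      intro y hy hn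
      by_cases hl : y.loc = x.loc
      · obtain rfl := h.loc_inj y hy x hxt hl
        exact ⟨by simpa [hcell] using hdata, .inr (by simp)⟩
      · change (cell' _).isSet ≠ _ at hn
        change (cell' _).data = _ ∧ _
        rw [hother _ hl] at hn ⊢
        exact ⟨(h.nonempty y hy hn).1, (h.nonempty y hy hn).2.imp id (List.mem_cons_of_mem _)⟩
    lt_tail := by
      intro l hn
      by_cases hl : l = x.loc
      · subst hl; exact h.loc_lt x hxt
      · change (cell' _).isSet ≠ _ at hn
        rw [hother _ hl] at hn
        exact h.lt_tail l hn
    term := h.term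
    prod := by
      refine forall_update_valid (p := fun u st => st.Valid A.hist A.tickets cell' u)
        ⟨hxt, rfl, hp, by rw [hself]; simp⟩ fun u hu => ?_
      refine (h.prod u).mono subset_rfl (fun y hy hy' => absurd hy hy') ?_
      rintro y hy rfl
      exact hother _ (h.thread_ne hxt hy hu)
    cons := h.cons }

/-- A snapshot: the enqueues whose elements have been set since the previous one enter the
linearization. -/
theorem Abs.Inv.snapshot (h : A.Inv) : ∃ S Q,
    ({ A with seq := S, queue := Q, fresh := [], snap := A.hist.length } : Abs P V).Inv := by
  let N := A.fresh.insertionSort (fun x y => x.loc ≤ y.loc)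
  have hN : N.Perm A.fresh := List.perm_insertionSort _ _
  have hmem : ∀ x, x ∈ N ↔ x ∈ A.fresh := fun x => hN.mem_iff
  have htk : ∀ x ∈ N, x ∈ A.tickets := fun x hx => h.fresh_mem x ((hmem x).1 hx)
  have hNs : N.Pairwise (fun x y => x.loc < y.loc ∧ x.time ≤ y.time ∧ x.index ≠ y.index) := by
    have h1 : N.Pairwise (fun x y => x.loc ≤ y.loc) := by
      have : Std.Total (fun x y : Ticket P V => x.loc ≤ y.loc) := ⟨fun x y => le_total _ _⟩
      have : IsTrans (Ticket P V) (fun x y => x.loc ≤ y.loc) := ⟨fun x y z => le_trans⟩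
      exact List.pairwise_insertionSort _ _
    have h2 : N.Pairwise (· ≠ ·) := (hN.nodup_iff.2 h.fresh_nodup)
    refine (h1.and h2).imp_of_mem ?_
    rintro x y hx hy ⟨hle, hne⟩
    have hlt : x.loc < y.loc :=
      lt_of_le_of_ne hle fun hl => hne (h.loc_inj x (htk x hx) y (htk y hy) hl)
    exact ⟨hlt, h.time_mono x (htk x hx) y (htk y hy) hlt,
      fun hi => hne (h.index_inj x (htk x hx) y (htk y hy) hi)⟩
  have hsnap : ∀ w ∈ N, ∀ j r, TerminatesAt A.hist w.index j r → A.snap ≤ j := fun w hw =>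
    h.fresh_term w ((hmem w).1 hw)
  obtain ⟨S, Q, hW, hS, hQ⟩ := h.witness.insert_list N hNs
    (by
      intro w hw y hy hyw
      cases y with
      | enq y =>
        have h1 := h.enq_mem y hy
        obtain rfl := h.index_inj y h1.1 w (htk w hw) hyw
        exact h1.2.2 ((hmem y).1 hw)
      | deq i x =>
        have h1 := h.deq_hist i x hy
        change i = w.index at hyw
        rw [hyw, h.ticket_hist w (htk w hw)] at h1
        simp at h1)
    (by
      intro w hw x hx hl
      obtain rfl := h.loc_inj x (h.queue_mem hx).1 w (htk w hw) hl
      exact (h.queue_mem hx).2.2 ((hmem x).1 hw))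
    (fun w hw x hx hl => h.time_mono w (htk w hw) x (h.queue_mem hx).1 hl)
    (fun w hw => (h.ticket_time w (htk w hw)).1)
    (fun w hw j r hj => (h.ticket_term w (htk w hw) j r hj).2.2)
    (fun x hx j r hj => (h.ticket_term x (h.queue_mem hx).1 j r hj).2.2)
    (by
      rintro w hw y hy ⟨j, r, hj, hjy, -⟩
      have h1 := hsnap w hw j r hj
      have h2 := h.seq_lt y hy
      omega)
    (fun w hw x hx j r hj => (h.queue_time x hx).trans (hsnap w hw j r hj))
  have hmS : ∀ y, y ∈ S ↔ (∃ x ∈ A.fresh, y = .enq x) ∨ y ∈ A.seq := fun y => by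
    rw [hS.mem_iff, List.mem_append, List.mem_map]
    simp only [hmem, eq_comm]
  have hmQ : ∀ x, x ∈ Q ↔ x ∈ A.fresh ∨ x ∈ A.queue := fun x => by
    rw [hQ.mem_iff, List.mem_append, hmem]
  have hdS : ∀ i x, .deq i x ∈ S ↔ .deq i x ∈ A.seq := fun i x => by simp [hmS]
  have heS : ∀ x, .enq x ∈ S ↔ x ∈ A.fresh ∨ .enq x ∈ A.seq := fun x => by simp [hmS]
  refine ⟨S, Q, {
    witness := hW
    snap_le := le_rfl
    seq_lt := ?_
    queue_time := ?_
    deq_hist := fun i x hx => h.deq_hist i x ((hdS i x).1 hx)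
    deq_term := fun i x hx => h.deq_term i x ((hdS i x).1 hx)
    enq_mem := ?_
    loc_lt := h.loc_lt
    ticket_hist := h.ticket_hist
    ticket_time := h.ticket_time
    loc_inj := h.loc_inj
    index_inj := h.index_inj
    time_mono := h.time_mono
    ticket_term := h.ticket_term
    fresh_term := by simp
    fresh_mem := by simp
    fresh_nodup := by simp
    set_iff := ?_
    nonempty := ?_
    lt_tail := h.lt_tail
    term := ?_
    prod := h.prod
    cons := ?_ }⟩
  · intro y hy
    rcases (hmS y).1 hy with ⟨x, hx, rfl⟩ | hy
    · have := h.ticket_time x (h.fresh_mem x hx)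
      exact this.1.trans_le this.2
    · exact (h.seq_lt y hy).trans_le h.snap_le
  · intro x hx
    rcases (hmQ x).1 hx with hx | hx
    · exact (h.ticket_time x (h.fresh_mem x hx)).2
    · exact (h.queue_time x hx).trans h.snap_le
  · intro x hx
    rcases (heS x).1 hx with hx | hx
    · refine ⟨h.fresh_mem x hx, ?_, by simp⟩
      change (A.cell x.loc).isSet ≠ _
      rw [(h.set_iff x.loc).2 ⟨x, .inr hx, rfl⟩]
      simp
    · exact ⟨(h.enq_mem x hx).1, (h.enq_mem x hx).2.1, by simp⟩
  · intro l
    refine (h.set_iff l).trans ?_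
    simp only [hmQ, List.not_mem_nil, or_false]
    exact exists_congr fun x => by rw [or_comm]
  · intro x hx hne
    refine ⟨(h.nonempty x hx hne).1, .inl ((heS x).2 (h.nonempty x hx hne).2.symm)⟩
  · intro i j r hj
    exact (h.term i j r hj).imp id fun ⟨y, hy, hyi⟩ => ⟨y, (hmS y).2 (.inr hy), hyi⟩
  · have hc := h.cons
    change A.cons.Valid A.hist S
    cases hA : A.cons with
    | idle => trivial
    | active i =>
      rw [hA] at hc
      refine ⟨hc.1, hc.2.1, fun y hy => ?_⟩
      rcases (hmS y).1 hy with ⟨x, hx, rfl⟩ | hy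
      · rintro rfl
        have h1 := hc.2.1
        change A.hist[x.index]? = _ at h1
        rw [h.ticket_hist x (h.fresh_mem x hx)] at h1
        simp at h1
      · exact hc.2.2 y hy
    | finished i r =>
      rw [hA] at hc
      obtain ⟨h1, x, hx, hr⟩ := hc
      exact ⟨h1, x, (hdS i x).2 hx, hr⟩

/-- A dequeue can be linearized at the latest snapshot as one that finds the queue empty if
nothing was set at that time. -/
theorem Abs.Inv.commitEmpty (h : A.Inv) (i : ℕ) (hc : A.cons = .active i) (hi : i < A.snap)
    (hQ : A.queue = []) :
    ({ A with seq := A.seq ++ [.deq i none], cons := .finished i .retFalse } : Abs P V).Inv := by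
  have hv := h.cons
  rw [hc] at hv
  obtain ⟨hp, hih, hnew⟩ := hv
  have hdS : ∀ k x, Entry.deq k x ∈ A.seq ++ [.deq i none] ↔
      .deq k x ∈ A.seq ∨ k = i ∧ x = none := by simp
  have heS : ∀ x, Entry.enq x ∈ A.seq ++ [.deq i none] ↔ .enq x ∈ A.seq := by simp
  exact {
    witness := h.witness.append_deq i none (by rw [hQ]; exact .deqEmpty _ (.nil _))
      (List.Sublist.refl _) hnew fun _ _ => hp.not_terminatesAt
    snap_le := h.snap_le
    seq_lt := by
      intro y hy
      rcases List.mem_append.1 hy with hy | hy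
      · exact h.seq_lt y hy
      · rw [List.mem_singleton.1 hy]; exact hi
    queue_time := h.queue_time
    deq_hist := by
      intro k x hx
      rcases (hdS k x).1 hx with hx | ⟨rfl, rfl⟩
      · exact h.deq_hist k x hx
      · exact hih
    deq_term := by
      intro k x hx j r hj
      rcases (hdS k x).1 hx with hx | ⟨rfl, rfl⟩
      · exact h.deq_term k x hx j r hj
      · exact absurd hj hp.not_terminatesAt
    enq_mem := fun x hx => h.enq_mem x ((heS x).1 hx)
    loc_lt := h.loc_lt
    ticket_hist := h.ticket_hist
    ticket_time := h.ticket_time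
    loc_inj := h.loc_inj
    index_inj := h.index_inj
    time_mono := h.time_mono
    ticket_term := h.ticket_term
    fresh_term := h.fresh_term
    fresh_mem := h.fresh_mem
    fresh_nodup := h.fresh_nodup
    set_iff := h.set_iff
    nonempty := fun x hx hne =>
      ⟨(h.nonempty x hx hne).1, (h.nonempty x hx hne).2.imp (heS x).2 id⟩
    lt_tail := h.lt_tail
    term := fun k j r hj => (h.term k j r hj).imp id
      fun ⟨y, hy, hyi⟩ => ⟨y, List.mem_append_left _ hy, hyi⟩
    prod := h.prod
    cons := ⟨hp, none, by simp, rfl⟩ }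

/-- A dequeue can be linearized at the latest snapshot as one that removes the first element that
was set at that time. -/
theorem Abs.Inv.commitDequeue (h : A.Inv) (i : ℕ) (hc : A.cons = .active i) (hi : i < A.snap)
    (u : Ticket P V) (Q : List (Ticket P V)) (hQ : A.queue = u :: Q) :
    ({ A with
      seq := A.seq ++ [.deq i (some u)]
      queue := Q
      cell := Function.update A.cell u.loc { A.cell u.loc with isSet := .handled }
      cons := .finished i (.retTrue (some u.val)) } : Abs P V).Inv := by
  have hv := h.cons
  rw [hc] at hv
  obtain ⟨hp, hih, hnew⟩ := hv
  have huQ : u ∈ A.queue := by simp [hQ]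
  have hsub : ∀ x ∈ Q, x ∈ A.queue := fun x hx => by simp [hQ, hx]
  obtain ⟨hut, -, huf⟩ := h.queue_mem huQ
  have hus := h.queue_set huQ
  set cell' := Function.update A.cell u.loc { A.cell u.loc with isSet := .handled } with hcell
  have hself : cell' u.loc = { A.cell u.loc with isSet := .handled } := by simp [hcell]
  have hother : ∀ l, l ≠ u.loc → cell' l = A.cell l := fun l hl => by simp [hcell, hl]
  have hempty : ∀ l, (cell' l).isSet = .empty ↔ (A.cell l).isSet = .empty := by
    intro l
    by_cases hl : l = u.loc
    · subst hl; rw [hself, hus]; simp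
    · rw [hother l hl]
  have hdata : ∀ l, (cell' l).data = (A.cell l).data := by
    intro l
    by_cases hl : l = u.loc
    · subst hl; rw [hself]
    · rw [hother l hl]
  have hdS : ∀ k x, Entry.deq k x ∈ A.seq ++ [.deq i (some u)] ↔
      .deq k x ∈ A.seq ∨ k = i ∧ x = some u := by simp
  have heS : ∀ x, Entry.enq x ∈ A.seq ++ [.deq i (some u)] ↔ .enq x ∈ A.seq := by simp
  exact {
    witness := h.witness.append_deq i (some u) (by rw [hQ]; exact .deq _ _ (.nil _))
      (by rw [hQ]; exact List.sublist_cons_self _ _) hnew fun _ _ => hp.not_terminatesAt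
    snap_le := h.snap_le
    seq_lt := by
      intro y hy
      rcases List.mem_append.1 hy with hy | hy
      · exact h.seq_lt y hy
      · rw [List.mem_singleton.1 hy]; exact hi
    queue_time := fun x hx => h.queue_time x (hsub x hx)
    deq_hist := by
      intro k x hx
      rcases (hdS k x).1 hx with hx | ⟨rfl, rfl⟩
      · exact h.deq_hist k x hx
      · exact hih
    deq_term := by
      intro k x hx j r hj
      rcases (hdS k x).1 hx with hx | ⟨rfl, rfl⟩
      · exact h.deq_term k x hx j r hj
      · exact absurd hj hp.not_terminatesAt
    enq_mem := fun x hx => by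
      obtain ⟨h1, h2, h3⟩ := h.enq_mem x ((heS x).1 hx)
      exact ⟨h1, (hempty _).not.2 h2, h3⟩
    loc_lt := h.loc_lt
    ticket_hist := h.ticket_hist
    ticket_time := h.ticket_time
    loc_inj := h.loc_inj
    index_inj := h.index_inj
    time_mono := h.time_mono
    ticket_term := fun x hx j r hj =>
      ⟨(hempty _).not.2 (h.ticket_term x hx j r hj).1, (h.ticket_term x hx j r hj).2⟩
    fresh_term := h.fresh_term
    fresh_mem := h.fresh_mem
    fresh_nodup := h.fresh_nodup
    set_iff := by
      intro l
      change (cell' l).isSet = _ ↔ ∃ x, (x ∈ Q ∨ x ∈ A.fresh) ∧ x.loc = l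
      by_cases hl : l = u.loc
      · subst hl
        rw [hself]
        simp only [reduceCtorEq, false_iff]
        rintro ⟨x, hx | hx, hxl⟩
        · have := h.witness.sorted
          rw [hQ] at this
          exact ((List.pairwise_cons.1 this).1 x hx).ne' hxl
        · rw [h.loc_inj x (h.fresh_mem x hx) u hut hxl] at hx
          exact huf hx
      · rw [hother l hl, h.set_iff l, hQ]
        simp only [List.mem_cons]
        constructor
        · rintro ⟨x, (rfl | hx) | hx, hxl⟩
          · exact absurd hxl.symm hl
          · exact ⟨x, .inl hx, hxl⟩
          · exact ⟨x, .inr hx, hxl⟩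
        · rintro ⟨x, hx, hxl⟩
          exact ⟨x, hx.imp .inr id, hxl⟩
    nonempty := fun x hx hne => by
      have := h.nonempty x hx ((hempty _).not.1 hne)
      exact ⟨(hdata _).trans this.1, this.2.imp (heS x).2 id⟩
    lt_tail := fun l hl => h.lt_tail l ((hempty _).not.1 hl)
    term := fun k j r hj => (h.term k j r hj).imp id
      fun ⟨y, hy, hyi⟩ => ⟨y, List.mem_append_left _ hy, hyi⟩
    prod := by
      intro t
      have ht := h.prod t
      change (A.prod t).Valid A.hist A.tickets cell' t
      cases hA : A.prod t with
      | idle => trivial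
      | called k v => rw [hA] at ht; exact ht
      | placed x =>
        rw [hA] at ht
        exact ⟨ht.1, ht.2.1, ht.2.2.1, (hempty _).2 ht.2.2.2⟩
      | stored x =>
        rw [hA] at ht
        exact ⟨ht.1, ht.2.1, ht.2.2.1, (hempty _).2 ht.2.2.2.1, (hdata _).trans ht.2.2.2.2⟩
      | finished x =>
        rw [hA] at ht
        exact ⟨ht.1, ht.2.1, ht.2.2.1, (hempty _).not.2 ht.2.2.2⟩
    cons := ⟨hp, some u, by simp, rfl⟩ }

theorem Abs.Inv.linearizable (h : A.Inv) : Linearizable A.hist := by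
  obtain ⟨S, Q, h⟩ := h.snapshot
  refine ⟨S.map Entry.toSeqOp, ?_, ?_, ?_, ?_, h.witness.runs.legalFrom⟩
  · rw [List.map_map]
    exact h.witness.nodup
  · intro o ho
    obtain ⟨y, hy, rfl⟩ := List.mem_map.1 ho
    cases y with
    | enq x =>
      have hx := (h.enq_mem x hy).1
      exact ⟨⟨_, h.ticket_hist x hx⟩, fun j r hj => (h.ticket_term x hx j r hj).2.1.symm⟩
    | deq i x => exact ⟨⟨_, h.deq_hist i x hy⟩, h.deq_term i x hy⟩
  · intro i j r hj
    suffices ∃ y ∈ S, y.index = i by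
      obtain ⟨y, hy, hyi⟩ := this
      exact ⟨_, List.mem_map_of_mem hy, hyi⟩
    rcases h.term i j r hj with ⟨x, hx, rfl⟩ | hy
    · rcases (h.nonempty x hx (h.ticket_term x hx j r hj).1).2 with hx' | hx'
      · exact ⟨_, hx', rfl⟩
      · simp at hx'
    · exact hy
  · rw [List.pairwise_map]
    exact h.witness.order

/-- The abstract queue at the beginning. -/
def Abs.init (P V : Type*) : Abs P V where
  hist := []
  tail := 0
  cell := fun _ => ⟨none, .empty⟩
  tickets := ∅
  seq := []
  queue := []
  fresh := []
  snap := 0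
  prod := fun _ => .idle
  cons := .idle

theorem not_terminatesAt_nil {i j : ℕ} {r : Response V} :
    ¬ TerminatesAt ([] : List (Event P V)) i j r := by
  rintro ⟨t, op, h, -⟩
  simp at h

theorem Abs.inv_init (P V : Type*) : (Abs.init P V).Inv where
  witness := ⟨.nil _, .nil, .nil, .nil, .nil⟩
  snap_le := le_rfl
  seq_lt := by simp [Abs.init]
  queue_time := by simp [Abs.init]
  deq_hist := by simp [Abs.init]
  deq_term := by simp [Abs.init]
  enq_mem := by simp [Abs.init]
  loc_lt := by simp [Abs.init]
  ticket_hist := by simp [Abs.init]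
  ticket_time := by simp [Abs.init]
  loc_inj := by simp [Abs.init]
  index_inj := by simp [Abs.init]
  time_mono := by simp [Abs.init]
  ticket_term := by simp [Abs.init]
  fresh_term := by simp [Abs.init]
  fresh_mem := by simp [Abs.init]
  fresh_nodup := by simp [Abs.init]
  set_iff := by simp [Abs.init]
  nonempty := by simp [Abs.init]
  lt_tail := by simp [Abs.init]
  term i j r h := absurd h not_terminatesAt_nil
  prod _ := trivial
  cons := trivial

end Abs

/-! ### The linked list of buffers -/

/-- The invariant of the shared memory. The list `L` contains all buffers that have ever been
linked, also those that have been unlinked since, in the order of their positions, which start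
with `1`; `h` and `t` are the indices in it of `headOfQueue` and `tailOfQueue`, and `cell` is the
array of nodes that the buffers make up. Pointers `next` and `prev` skip only nodes that are
`handled`. -/
structure MemInv {V : Type*} (b : ℕ) (m : Memory V) (L : List Ptr) (cell : ℕ → Node V)
    (h t : ℕ) : Prop where
  nodup : L.Nodup
  lt_fresh : ∀ p ∈ L, p < m.fresh
  pos : ∀ k p, L[k]? = some p → (m.heap p).positionInQueue = k + 1
  node : ∀ k p i, L[k]? = some p → i < b → (m.heap p).currBuffer i = cell (b * k + i)
  beyond : ∀ l, b * L.length ≤ l → cell l = ⟨none, .empty⟩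
  next_none : ∀ k p, L[k]? = some p → (m.heap p).next = none → k + 1 = L.length
  next_some : ∀ k p q, L[k]? = some p → (m.heap p).next = some q →
    ∃ j, k < j ∧ L[j]? = some q ∧ ∀ l, b * (k + 1) ≤ l → l < b * j → (cell l).isSet = .handled
  prev_some : ∀ k p q, L[k]? = some p → (m.heap p).prev = some q →
    ∃ j, j < k ∧ L[j]? = some q ∧ ∀ l, b * (j + 1) ≤ l → l < b * k → (cell l).isSet = .handled
  head_eq_zero : ∀ k p, L[k]? = some p → h < k → (m.heap p).head = 0
  headOfQueue : L[h]? = some m.headOfQueue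
  head_le : m.head ≤ b
  handled : ∀ l, l < b * h + m.head → (cell l).isSet = .handled
  tailOfQueue : L[t]? = some m.tailOfQueue
  lt_tail : ∀ l, (cell l).isSet ≠ .empty → l < b * (t + 1)

/-- The buffer `new` has been allocated to follow the buffer `tmp`, but has not been linked. -/
def IsPrivate {V : Type*} (m : Memory V) (L : List Ptr) (tmp new : Ptr) : Prop :=
  new < m.fresh ∧ new ∉ L ∧
    ∃ k, L[k]? = some tmp ∧ m.heap new = BufferList.new V (k + 2) (some tmp)

section Memory

variable {V : Type*} {b : ℕ} {m : Memory V} {L : List Ptr} {cell : ℕ → Node V} {h t : ℕ}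

theorem index_eq_of_nodup {L : List Ptr} (hL : L.Nodup) {j k : ℕ} {p : Ptr} (hj : L[j]? = some p)
    (hk : L[k]? = some p) : j = k :=
  (List.getElem?_inj (List.getElem?_eq_some_iff.1 hj).1 hL).1 (hj.trans hk.symm)

theorem MemInv.index_inj (H : MemInv b m L cell h t) {j k : ℕ} {p : Ptr} (hj : L[j]? = some p)
    (hk : L[k]? = some p) : j = k :=
  index_eq_of_nodup H.nodup hj hk

theorem MemInv.prevSize (H : MemInv b m L cell h t) {k : ℕ} {p : Ptr} (hk : L[k]? = some p) :
    m.prevSize b p = b * k := by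
  rw [Memory.prevSize, H.pos k p hk, Nat.add_sub_cancel]

theorem MemInv.node_eq (H : MemInv b m L cell h t) {k i : ℕ} {p : Ptr} (hk : L[k]? = some p)
    (hi : i < b) : m.node p i = cell (b * k + i) :=
  H.node k p i hk hi

theorem MemInv.head_node (H : MemInv b m L cell h t) (hi : m.head < b) :
    m.node m.headOfQueue m.head = cell (b * h + m.head) :=
  H.node_eq H.headOfQueue hi

theorem MemInv.tail_lt_length (H : MemInv b m L cell h t) : t < L.length :=
  (List.getElem?_eq_some_iff.1 H.tailOfQueue).1

/-- One of the linked buffers changes. -/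
theorem MemInv.modify (H : MemInv b m L cell h t) {k : ℕ} {p : Ptr} (hk : L[k]? = some p)
    (f : BufferList V → BufferList V) (cell' : ℕ → Node V)
    (hpos : (f (m.heap p)).positionInQueue = (m.heap p).positionInQueue)
    (hnode : ∀ i, i < b → (f (m.heap p)).currBuffer i = cell' (b * k + i))
    (hcell : ∀ j i, j ≠ k → i < b → cell' (b * j + i) = cell (b * j + i))
    (hbeyond : ∀ l, b * L.length ≤ l → cell' l = cell l)
    (hhandled : ∀ l, (cell l).isSet = .handled → (cell' l).isSet = .handled)
    (hnext_none : (f (m.heap p)).next = none → (m.heap p).next = none)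
    (hnext_some : ∀ q, (f (m.heap p)).next = some q → ∃ j, k < j ∧ L[j]? = some q ∧
      ∀ l, b * (k + 1) ≤ l → l < b * j → (cell l).isSet = .handled)
    (hprev_some : ∀ q, (f (m.heap p)).prev = some q → ∃ j, j < k ∧ L[j]? = some q ∧
      ∀ l, b * (j + 1) ≤ l → l < b * k → (cell l).isSet = .handled)
    (hhead0 : h < k → (f (m.heap p)).head = 0)
    (hhead : k = h → (f (m.heap p)).head ≤ b ∧
      ∀ l, l < b * h + (f (m.heap p)).head → (cell' l).isSet = .handled)
    (hlt : ∀ l, (cell' l).isSet ≠ .empty → l < b * (t + 1)) :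
    MemInv b (m.modify p f) L cell' h t := by
  have hself : (m.modify p f).heap p = f (m.heap p) := by simp [Memory.modify]
  have hother : ∀ (j : ℕ) (q : Ptr), L[j]? = some q → j ≠ k → (m.modify p f).heap q = m.heap q := by
    intro j q hq hj
    have : q ≠ p := by rintro rfl; exact hj (H.index_inj hq hk)
    simp [Memory.modify, this]
  have hcase : ∀ (j : ℕ) (q : Ptr), L[j]? = some q →
      j = k ∧ q = p ∨ j ≠ k ∧ (m.modify p f).heap q = m.heap q := by
    intro j q hq
    by_cases hj : j = k
    · subst hj
      rw [hq] at hk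
      exact .inl ⟨rfl, by simpa using hk⟩
    · exact .inr ⟨hj, hother j q hq hj⟩
  have hhd : k = h → (m.modify p f).head = (f (m.heap p)).head := by
    rintro rfl
    have h1 := H.headOfQueue
    rw [hk] at h1
    cases h1
    rw [← hself]
    rfl
  have hhd' : k ≠ h → (m.modify p f).head = m.head := by
    intro hkh
    exact congrArg BufferList.head (hother h _ H.headOfQueue (Ne.symm hkh))
  exact {
    nodup := H.nodup
    lt_fresh := H.lt_fresh
    pos := by
      intro j q hq
      rcases hcase j q hq with ⟨rfl, rfl⟩ | ⟨-, he⟩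
      · rw [hself, hpos, H.pos j q hq]
      · rw [he, H.pos j q hq]
    node := by
      intro j q i hq hi
      rcases hcase j q hq with ⟨rfl, rfl⟩ | ⟨hj, he⟩
      · rw [hself, hnode i hi]
      · rw [he, H.node j q i hq hi, hcell j i hj hi]
    beyond := fun l hl => (hbeyond l hl).trans (H.beyond l hl)
    next_none := by
      intro j q hq hn
      rcases hcase j q hq with ⟨rfl, rfl⟩ | ⟨hj, he⟩
      · rw [hself] at hn
        exact H.next_none j q hq (hnext_none hn)
      · rw [he] at hn
        exact H.next_none j q hq hn
    next_some := by
      intro j q q' hq hn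
      suffices ∃ i, j < i ∧ L[i]? = some q' ∧
          ∀ l, b * (j + 1) ≤ l → l < b * i → (cell l).isSet = .handled by
        obtain ⟨i, h1, h2, h3⟩ := this
        exact ⟨i, h1, h2, fun l h4 h5 => hhandled l (h3 l h4 h5)⟩
      rcases hcase j q hq with ⟨rfl, rfl⟩ | ⟨hj, he⟩
      · rw [hself] at hn
        exact hnext_some q' hn
      · rw [he] at hn
        exact H.next_some j q q' hq hn
    prev_some := by
      intro j q q' hq hn
      suffices ∃ i, i < j ∧ L[i]? = some q' ∧
          ∀ l, b * (i + 1) ≤ l → l < b * j → (cell l).isSet = .handled by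
        obtain ⟨i, h1, h2, h3⟩ := this
        exact ⟨i, h1, h2, fun l h4 h5 => hhandled l (h3 l h4 h5)⟩
      rcases hcase j q hq with ⟨rfl, rfl⟩ | ⟨hj, he⟩
      · rw [hself] at hn
        exact hprev_some q' hn
      · rw [he] at hn
        exact H.prev_some j q q' hq hn
    head_eq_zero := by
      intro j q hq hj
      rcases hcase j q hq with ⟨rfl, rfl⟩ | ⟨-, he⟩
      · rw [hself, hhead0 hj]
      · rw [he, H.head_eq_zero j q hq hj]
    headOfQueue := H.headOfQueue
    head_le := by
      by_cases hkh : k = h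
      · rw [hhd hkh]; exact (hhead hkh).1
      · rw [hhd' hkh]; exact H.head_le
    handled := by
      intro l hl
      by_cases hkh : k = h
      · rw [hhd hkh] at hl; exact (hhead hkh).2 l hl
      · rw [hhd' hkh] at hl; exact hhandled l (H.handled l hl)
    tailOfQueue := H.tailOfQueue
    lt_tail := hlt }

/-- A change of a linked buffer that concerns neither the nodes nor the position. -/
theorem MemInv.modify_pointers (H : MemInv b m L cell h t) {k : ℕ} {p : Ptr}
    (hk : L[k]? = some p) (f : BufferList V → BufferList V)
    (hpos : (f (m.heap p)).positionInQueue = (m.heap p).positionInQueue)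
    (hnode : (f (m.heap p)).currBuffer = (m.heap p).currBuffer)
    (hhead : (f (m.heap p)).head = (m.heap p).head)
    (hnext_none : (f (m.heap p)).next = none → (m.heap p).next = none)
    (hnext_some : ∀ q, (f (m.heap p)).next = some q → ∃ j, k < j ∧ L[j]? = some q ∧
      ∀ l, b * (k + 1) ≤ l → l < b * j → (cell l).isSet = .handled)
    (hprev_some : ∀ q, (f (m.heap p)).prev = some q → ∃ j, j < k ∧ L[j]? = some q ∧
      ∀ l, b * (j + 1) ≤ l → l < b * k → (cell l).isSet = .handled) :
    MemInv b (m.modify p f) L cell h t := by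
  refine H.modify hk f cell hpos (fun i hi => ?_) (fun _ _ _ _ => rfl) (fun _ _ => rfl)
    (fun _ => id) hnext_none hnext_some hprev_some (fun hlt => ?_) (fun hkh => ?_) H.lt_tail
  · rw [hnode, H.node k p i hk hi]
  · rw [hhead, H.head_eq_zero k p hk hlt]
  · subst hkh
    have h1 := H.headOfQueue
    rw [hk] at h1
    cases h1
    rw [hhead]
    exact ⟨H.head_le, H.handled⟩

theorem mul_add_ne_mul_add {b j k i l : ℕ} (hi : i < b) (hl : l < b) (hjk : j ≠ k) :
    b * j + i ≠ b * k + l := by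
  intro he
  have h1 : (b * j + i) / b = j := by
    rw [Nat.mul_add_div (by omega), Nat.div_eq_of_lt hi, Nat.add_zero]
  have h2 : (b * k + l) / b = k := by
    rw [Nat.mul_add_div (by omega), Nat.div_eq_of_lt hl, Nat.add_zero]
  rw [he, h2] at h1
  exact hjk h1.symm

/-- A node changes that is not handled yet. -/
theorem MemInv.modifyNode (H : MemInv b m L cell h t) {k i : ℕ} {p : Ptr} (hk : L[k]? = some p)
    (hi : i < b) (hkt : k ≤ t) (f : Node V → Node V)
    (hf : (cell (b * k + i)).isSet = .handled → (f (cell (b * k + i))).isSet = .handled) :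
    MemInv b (m.modifyNode p i f) L
      (Function.update cell (b * k + i) (f (cell (b * k + i)))) h t := by
  have hhan : ∀ l, (cell l).isSet = .handled →
      (Function.update cell (b * k + i) (f (cell (b * k + i))) l).isSet = .handled := by
    intro l hl
    by_cases hli : l = b * k + i
    · subst hli; simpa using hf hl
    · simpa [hli] using hl
  have hin : b * k + i < b * (t + 1) := calc
    b * k + i < b * (k + 1) := by rw [Nat.mul_succ]; omega
    _ ≤ b * (t + 1) := Nat.mul_le_mul_left _ (by omega)
  refine H.modify hk _ _ rfl (fun i' hi' => ?_) (fun j i' hj hi' => ?_) (fun l hl => ?_)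
    hhan id (fun q => H.next_some k p q hk) (fun q => H.prev_some k p q hk)
    (H.head_eq_zero k p hk) (fun hkh => ?_) (fun l hl => ?_)
  · have h1 : (m.heap p).currBuffer i = cell (b * k + i) := H.node k p i hk hi
    by_cases hii : i' = i
    · subst hii; simp [h1]
    · simp [hii, H.node k p i' hk hi']
  · rw [Function.update_of_ne (mul_add_ne_mul_add hi' hi hj)]
  · rw [Function.update_of_ne]
    have := H.tail_lt_length
    have : b * (t + 1) ≤ b * L.length := Nat.mul_le_mul_left _ (by omega)
    omega
  · subst hkh
    have h1 := H.headOfQueue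
    rw [hk] at h1
    cases h1
    exact ⟨H.head_le, fun l hl => hhan l (H.handled l hl)⟩
  · by_cases hli : l = b * k + i
    · exact hli ▸ hin
    · rw [Function.update_of_ne hli] at hl
      exact H.lt_tail l hl

theorem MemInv.advanceHead (H : MemInv b m L cell h t) (hlt : m.head < b)
    (hn : (cell (b * h + m.head)).isSet = .handled) : MemInv b m.advanceHead L cell h t := by
  refine H.modify H.headOfQueue _ _ rfl (fun i hi => H.node h _ i H.headOfQueue hi)
    (fun _ _ _ _ => rfl) (fun _ _ => rfl) (fun _ => id) id
    (fun q => H.next_some h _ q H.headOfQueue) (fun q => H.prev_some h _ q H.headOfQueue)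
    (fun hh => absurd hh (lt_irrefl _)) (fun _ => ⟨hlt, fun l hl => ?_⟩) H.lt_tail
  change l < b * h + (m.head + 1) at hl
  rcases Nat.lt_succ_iff_lt_or_eq.1 hl with hl | rfl
  · exact H.handled l hl
  · exact hn

theorem Memory.head_advanceHead (m : Memory V) : m.advanceHead.head = m.head + 1 := by
  simp [Memory.advanceHead, Memory.modify, Memory.head]

theorem MemInv.moveHead (H : MemInv b m L cell h t) (hb : b ≤ m.head) {nxt : Ptr}
    (hn : (m.heap m.headOfQueue).next = some nxt) :
    ∃ h', MemInv b { m with headOfQueue := nxt } L cell h' t := by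
  obtain ⟨j, hj, hjn, hh⟩ := H.next_some h _ nxt H.headOfQueue hn
  have h0 : (m.heap nxt).head = 0 := H.head_eq_zero j nxt hjn hj
  refine ⟨j, { H with
    head_eq_zero := fun k p hk hjk => H.head_eq_zero k p hk (hj.trans hjk)
    headOfQueue := hjn
    head_le := ?_
    handled := ?_ }⟩
  · change (m.heap nxt).head ≤ b
    omega
  · intro l hl
    change l < b * j + (m.heap nxt).head at hl
    rw [h0] at hl
    by_cases hlt : l < b * h + m.head
    · exact H.handled l hlt
    · exact hh l (by rw [Nat.mul_succ]; omega) (by omega)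

theorem MemInv.moveTail (H : MemInv b m L cell h t) {new : Ptr} {j : ℕ} (hj : L[j]? = some new)
    (htj : t ≤ j) : MemInv b { m with tailOfQueue := new } L cell h j :=
  { H with
    tailOfQueue := hj
    lt_tail := fun l hl => (H.lt_tail l hl).trans_le (Nat.mul_le_mul_left _ (by omega)) }

theorem MemInv.alloc (H : MemInv b m L cell h t) (p : Ptr) : MemInv b (m.alloc p) L cell h t := by
  have hheap : ∀ (k : ℕ) (q : Ptr), L[k]? = some q → (m.alloc p).heap q = m.heap q := by
    intro k q hq
    have := H.lt_fresh q (List.mem_of_getElem? hq)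
    simp [Memory.alloc, this.ne]
  have hhead : (m.alloc p).head = m.head :=
    congrArg BufferList.head (hheap h _ H.headOfQueue)
  exact {
    nodup := H.nodup
    lt_fresh := fun q hq => (H.lt_fresh q hq).trans (Nat.lt_succ_self _)
    pos := fun k q hq => by rw [hheap k q hq]; exact H.pos k q hq
    node := fun k q i hq hi => by rw [hheap k q hq]; exact H.node k q i hq hi
    beyond := H.beyond
    next_none := fun k q hq => by rw [hheap k q hq]; exact H.next_none k q hq
    next_some := fun k q q' hq => by rw [hheap k q hq]; exact H.next_some k q q' hq
    prev_some := fun k q q' hq => by rw [hheap k q hq]; exact H.prev_some k q q' hq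
    head_eq_zero := fun k q hq => by rw [hheap k q hq]; exact H.head_eq_zero k q hq
    headOfQueue := H.headOfQueue
    head_le := by rw [hhead]; exact H.head_le
    handled := by rw [hhead]; exact H.handled
    tailOfQueue := H.tailOfQueue
    lt_tail := H.lt_tail }

theorem MemInv.isPrivate_alloc (H : MemInv b m L cell h t) {p : Ptr} (hp : p ∈ L) :
    IsPrivate (m.alloc p) L p m.fresh := by
  obtain ⟨k, hk⟩ := List.mem_iff_getElem?.1 hp
  refine ⟨Nat.lt_succ_self _, fun hm => lt_irrefl _ (H.lt_fresh _ hm), k, hk, ?_⟩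
  simp [Memory.alloc, H.pos k p hk]

theorem IsPrivate.alloc {tmp new : Ptr} (hp : IsPrivate m L tmp new) (p : Ptr) :
    IsPrivate (m.alloc p) L tmp new := by
  obtain ⟨h1, h2, k, hk, h3⟩ := hp
  exact ⟨h1.trans (Nat.lt_succ_self _), h2, k, hk, by simpa [Memory.alloc, h1.ne] using h3⟩

theorem IsPrivate.modify {tmp new : Ptr} (hp : IsPrivate m L tmp new) {p : Ptr} (hpL : p ∈ L)
    (f : BufferList V → BufferList V) : IsPrivate (m.modify p f) L tmp new := by
  obtain ⟨h1, h2, k, hk, h3⟩ := hp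
  have : new ≠ p := by rintro rfl; exact h2 hpL
  exact ⟨h1, h2, k, hk, by simpa [Memory.modify, this] using h3⟩

theorem IsPrivate.append {tmp new : Ptr} (hp : IsPrivate m L tmp new) {p : Ptr} (hne : new ≠ p) :
    IsPrivate m (L ++ [p]) tmp new := by
  obtain ⟨h1, h2, k, hk, h3⟩ := hp
  exact ⟨h1, by simp [h2, hne], k, getElem?_append_of_eq_some hk _, h3⟩

/-- A successful CAS on `next` links a buffer at the end: only the last of the linked buffers has
no successor. -/
theorem MemInv.link (H : MemInv b m L cell h t) {tmp new : Ptr} (hp : IsPrivate m L tmp new)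
    (hnone : (m.heap tmp).next = none) :
    MemInv b (m.modify tmp fun B => { B with next := some new }) (L ++ [new]) cell h t ∧
      ∃ k, L[k]? = some tmp ∧ (L ++ [new])[k + 1]? = some new := by
  obtain ⟨hlt, hnL, k, hk, hnew⟩ := hp
  have hlen := H.next_none k tmp hk hnone
  set m' := m.modify tmp fun B => { B with next := some new } with hm'
  have hne : new ≠ tmp := by rintro rfl; exact hnL (List.mem_of_getElem? hk)
  have hnew' : m'.heap new = BufferList.new V (k + 2) (some tmp) := by
    simpa [hm', Memory.modify, hne] using hnew
  have htmp : m'.heap tmp = { m.heap tmp with next := some new } := by simp [hm', Memory.modify]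
  have hother : ∀ p, p ≠ tmp → m'.heap p = m.heap p := fun p hp => by simp [hm', Memory.modify, hp]
  have hcase : ∀ (j : ℕ) (p : Ptr), (L ++ [new])[j]? = some p →
      (L[j]? = some p) ∨ j = k + 1 ∧ p = new := by
    intro j p hj
    rw [List.getElem?_append] at hj
    split_ifs at hj with hjl
    · exact .inl hj
    · rw [List.getElem?_singleton] at hj
      split_ifs at hj with h0
      cases hj
      exact .inr ⟨by omega, rfl⟩
  have hlast : (L ++ [new])[k + 1]? = some new := by rw [hlen]; simp
  have hhead : m'.head = m.head := by
    change (m'.heap m.headOfQueue).head = (m.heap m.headOfQueue).head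
    by_cases hq : m.headOfQueue = tmp
    · rw [hq, htmp]
    · rw [hother _ hq]
  refine ⟨{
    nodup := List.nodup_append.2 ⟨H.nodup, by simp, ?_⟩
    lt_fresh := ?_
    pos := ?_
    node := ?_
    beyond := ?_
    next_none := ?_
    next_some := ?_
    prev_some := ?_
    head_eq_zero := ?_
    headOfQueue := getElem?_append_of_eq_some H.headOfQueue _
    head_le := by rw [hhead]; exact H.head_le
    handled := by rw [hhead]; exact H.handled
    tailOfQueue := getElem?_append_of_eq_some H.tailOfQueue _
    lt_tail := H.lt_tail }, k, hk, hlast⟩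
  · rintro a ha c hc rfl
    rw [List.mem_singleton] at hc
    exact hnL (hc ▸ ha)
  · intro p hp
    rcases List.mem_append.1 hp with hp | hp
    · exact H.lt_fresh p hp
    · rw [List.mem_singleton] at hp
      exact hp ▸ hlt
  · intro j p hj
    rcases hcase j p hj with hj | ⟨rfl, rfl⟩
    · by_cases hpt : p = tmp
      · rw [hpt] at hj ⊢
        rw [htmp]
        exact H.pos j tmp hj
      · rw [hother p hpt]
        exact H.pos j p hj
    · rw [hnew']
      rfl
  · intro j p i hj hi
    rcases hcase j p hj with hj | ⟨rfl, rfl⟩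
    · by_cases hpt : p = tmp
      · rw [hpt] at hj ⊢
        rw [htmp]
        exact H.node j tmp i hj hi
      · rw [hother p hpt]
        exact H.node j p i hj hi
    · rw [hnew', H.beyond _ (by rw [hlen]; omega)]
      rfl
  · intro l hl
    refine H.beyond l (le_trans (Nat.mul_le_mul_left _ ?_) hl)
    simp
  · intro j p hj hn
    rcases hcase j p hj with hj | ⟨rfl, rfl⟩
    · by_cases hpt : p = tmp
      · rw [hpt, htmp] at hn
        cases hn
      · rw [hother p hpt] at hn
        -- two different buffers would be the last one
        have := H.next_none j p hj hn
        obtain rfl : j = k := by omega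
        rw [hk] at hj
        cases hj
        exact absurd rfl hpt
    · simp [hlen]
  · intro j p q hj hn
    rcases hcase j p hj with hj | ⟨rfl, rfl⟩
    · by_cases hpt : p = tmp
      · rw [hpt] at hj
        obtain rfl := H.index_inj hj hk
        rw [hpt, htmp] at hn
        cases hn
        exact ⟨j + 1, Nat.lt_succ_self _, hlast, fun l h1 h2 => absurd h2 (not_lt.2 h1)⟩
      · rw [hother p hpt] at hn
        obtain ⟨i, h1, h2, h3⟩ := H.next_some j p q hj hn
        exact ⟨i, h1, getElem?_append_of_eq_some h2 _, h3⟩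
    · rw [hnew'] at hn
      cases hn
  · intro j p q hj hn
    rcases hcase j p hj with hj | ⟨rfl, rfl⟩
    · have hn : (m.heap p).prev = some q := by
        by_cases hpt : p = tmp
        · rw [hpt, htmp] at hn
          rw [hpt]
          exact hn
        · rwa [hother p hpt] at hn
      obtain ⟨i, h1, h2, h3⟩ := H.prev_some j p q hj hn
      exact ⟨i, h1, getElem?_append_of_eq_some h2 _, h3⟩
    · rw [hnew'] at hn
      cases hn
      exact ⟨k, Nat.lt_succ_self _, getElem?_append_of_eq_some hk _,
        fun l h1 h2 => absurd h2 (not_lt.2 h1)⟩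
  · intro j p hj hhj
    rcases hcase j p hj with hj | ⟨rfl, rfl⟩
    · by_cases hpt : p = tmp
      · rw [hpt] at hj ⊢
        rw [htmp]
        exact H.head_eq_zero j tmp hj hhj
      · rw [hother p hpt]
        exact H.head_eq_zero j p hj hhj
    · rw [hnew']
      rfl

theorem memInv_init (V : Type*) (b : ℕ) :
    MemInv b (Memory.init V) [0] (fun _ => ⟨none, .empty⟩) 0 0 := by
  have hk : ∀ k p, ([0] : List Ptr)[k]? = some p → k = 0 ∧ p = 0 := by
    intro k p hk
    rw [List.getElem?_singleton] at hk
    split_ifs at hk with h0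
    exact ⟨h0, by simpa using hk.symm⟩
  constructor
  · simp
  · simp [Memory.init]
  · intro k p h
    obtain ⟨rfl, rfl⟩ := hk k p h
    rfl
  · intro k p i _ _
    rfl
  · intro l _
    rfl
  · intro k p h _
    obtain ⟨rfl, rfl⟩ := hk k p h
    rfl
  · intro k p q _ hn
    cases hn
  · intro k p q _ hn
    cases hn
  · intro k p _ _
    rfl
  · rfl
  · exact Nat.zero_le _
  · intro l hl
    exact absurd hl (by simp [Memory.init, Memory.head, BufferList.new])
  · rfl
  · intro l hl
    exact absurd rfl hl

end Memory

/-! ### Simulation of the queue by the abstract queue -/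

/-- The buffer that an enqueue has allocated and is about to link, after the buffer that it is to
follow. -/
def EnqPC.priv {V : Type*} : EnqPC V → Option (Ptr × Ptr)
  | .casNext _ _ tmp new => some (tmp, new)
  | .preCasNext tmp new => some (tmp, new)
  | _ => none

/-- How the local state of an enqueue is related to the status of its producer and to the list `L`
of linked buffers, when `tailOfQueue` has index `t` in this list. -/
def EnqRel {P V : Type*} (b : ℕ) (L : List Ptr) (t : ℕ) (st : ProdStatus P V) : EnqPC V → Prop
  | .idle => st = .idle
  | .fetchAdd v => ∃ i, st = .called i v
  | .loadTail v loc => ∃ x, st = .placed x ∧ v = x.val ∧ loc = x.loc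
  | .loadNext v loc tmp => ∃ x, st = .placed x ∧ v = x.val ∧ loc = x.loc ∧ tmp ∈ L
  | .casNext v loc tmp _ => ∃ x, st = .placed x ∧ v = x.val ∧ loc = x.loc ∧ tmp ∈ L
  | .casTail v loc tmp new => ∃ x, st = .placed x ∧ v = x.val ∧ loc = x.loc ∧
      ∃ k j : ℕ, k < j ∧ L[k]? = some tmp ∧ L[j]? = some new
  | .walkBack v loc tmp _ => ∃ x, st = .placed x ∧ v = x.val ∧ loc = x.loc ∧
      ∃ k : ℕ, k ≤ t ∧ L[k]? = some tmp ∧ loc < b * (k + 1)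
  | .storeData v loc tmp _ => ∃ x, st = .placed x ∧ v = x.val ∧ loc = x.loc ∧
      ∃ k : ℕ, k ≤ t ∧ L[k]? = some tmp ∧ b * k ≤ loc ∧ loc < b * (k + 1)
  | .storeSet loc tmp _ => ∃ x, st = .stored x ∧ loc = x.loc ∧
      ∃ k : ℕ, k ≤ t ∧ L[k]? = some tmp ∧ b * k ≤ loc ∧ loc < b * (k + 1)
  | .preAlloc tmp => (∃ x, st = .finished x) ∧ tmp ∈ L
  | .preCasNext tmp _ => (∃ x, st = .finished x) ∧ tmp ∈ L
  | .preCasTail tmp new => (∃ x, st = .finished x) ∧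
      ∃ k j : ℕ, k < j ∧ L[k]? = some tmp ∧ L[j]? = some new
  | .ret => ∃ x, st = .finished x

/-- A dequeue which looks for an element: it has taken a snapshot, and what was set at that time
is located at `l` or later. -/
def Searching {P V : Type*} (A : Abs P V) (l : ℕ) : Prop :=
  (∃ i, A.cons = .active i ∧ i < A.snap) ∧ ∀ x ∈ A.queue, l ≤ x.loc

/-- All cells from `l` up to but excluding `r` are handled. -/
def AllHandled {V : Type*} (cell : ℕ → Node V) (l r : ℕ) : Prop :=
  ∀ i, l ≤ i → i < r → (cell i).isSet = .handled

/-- How the local state of a dequeue is related to the abstract queue and to the list `L` of linked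
buffers, when `headOfQueue` has index `h` in this list and the value `hd` of `head`. -/
def DeqRel {P V : Type*} (b hd : ℕ) (L : List Ptr) (h : ℕ) (A : Abs P V) : DeqPC V → Prop
  | .idle => A.cons = .idle
  | .skip => ∃ i, A.cons = .active i
  | .skipMoveTail | .skipMoveNext => (∃ i, A.cons = .active i) ∧ b ≤ hd
  | .checkEmpty | .checkFirst => (∃ i, A.cons = .active i) ∧ hd < b ∧
      (A.cell (b * h + hd)).isSet ≠ .handled
  | .scan p i all => hd < b ∧ i < b ∧ ∃ k : ℕ, h ≤ k ∧ L[k]? = some p ∧ Searching A (b * k + i) ∧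
      (all = true → h < k → AllHandled A.cell (b * k) (b * k + i))
  | .scanTail p i all => hd < b ∧ i < b ∧ ∃ k : ℕ, h ≤ k ∧ L[k]? = some p ∧
      Searching A (b * k + i + 1) ∧
      (all = true → h < k → AllHandled A.cell (b * k) (b * k + i + 1))
  | .scanNext p => hd < b ∧ ∃ k : ℕ, h ≤ k ∧ L[k]? = some p ∧ Searching A (b * (k + 1))
  | .foldTail p | .foldNext p => hd < b ∧ ∃ k : ℕ, h < k ∧ L[k]? = some p ∧
      Searching A (b * (k + 1)) ∧ AllHandled A.cell (b * k) (b * (k + 1))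
  | .foldPrev p nxt => hd < b ∧ ∃ k j : ℕ, h < k ∧ k < j ∧ L[k]? = some p ∧ L[j]? = some nxt ∧
      Searching A (b * j) ∧ AllHandled A.cell (b * k) (b * j)
  | .foldLink prv nxt => hd < b ∧ ∃ k j : ℕ, h < j ∧ k < j ∧ L[k]? = some prv ∧ L[j]? = some nxt ∧
      Searching A (b * j) ∧ AllHandled A.cell (b * (k + 1)) (b * j)
  | .rescan e tempN => hd < b ∧ e.2 < b ∧ tempN.2 < b ∧ ∃ k j : ℕ, h ≤ k ∧ L[k]? = some e.1 ∧
      L[j]? = some tempN.1 ∧ Searching A (b * k + e.2) ∧ ∃ x ∈ A.queue, x.loc = b * j + tempN.2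
  | .rescanNext p tempN => hd < b ∧ tempN.2 < b ∧ ∃ k j : ℕ, h ≤ k ∧ L[k]? = some p ∧
      L[j]? = some tempN.1 ∧ Searching A (b * (k + 1)) ∧ ∃ x ∈ A.queue, x.loc = b * j + tempN.2
  | .loadData tempN => hd < b ∧ tempN.2 < b ∧ ∃ j : ℕ, L[j]? = some tempN.1 ∧ Searching A 0 ∧
      ∃ x Q, A.queue = x :: Q ∧ x.loc = b * j + tempN.2
  | .markHandled tempN data => hd < b ∧ tempN.2 < b ∧ ∃ j : ℕ, L[j]? = some tempN.1 ∧
      Searching A 0 ∧ ∃ x Q, A.queue = x :: Q ∧ x.loc = b * j + tempN.2 ∧ data = some x.val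
  | .moveTail data | .moveNext data => (∃ i, A.cons = .finished i (.retTrue data)) ∧ b ≤ hd
  | .ret r => ∃ i, A.cons = .finished i r

/-- The abstract queue `A` represents the state `s`. -/
structure Sim {P V : Type*} (b : ℕ) (s : State P V) (A : Abs P V) (L : List Ptr) (h t : ℕ) :
    Prop where
  mem : MemInv b s.mem L A.cell h t
  tail : A.tail = s.mem.tail
  enq : ∀ u, EnqRel b L t (A.prod u) (s.enq u)
  priv : ∀ u tmp new, (s.enq u).priv = some (tmp, new) → IsPrivate s.mem L tmp new
  priv_inj : ∀ u u' tmp tmp' new, (s.enq u).priv = some (tmp, new) →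
    (s.enq u').priv = some (tmp', new) → u = u'
  deq : DeqRel b s.mem.head L h A s.deq

section Sim

variable {P V : Type*} {b : ℕ} {s : State P V} {A A' : Abs P V} {L : List Ptr} {h t : ℕ}

theorem EnqRel.mono {t' : ℕ} (ht : t ≤ t') (l : List Ptr) {st : ProdStatus P V} {pc : EnqPC V}
    (H : EnqRel b L t st pc) : EnqRel b (L ++ l) t' st pc := by
  have hat : ∀ {k : ℕ} {p : Ptr}, L[k]? = some p → (L ++ l)[k]? = some p :=
    fun hk => getElem?_append_of_eq_some hk l
  cases pc with
  | idle | fetchAdd | loadTail | ret => exact H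
  | loadNext | casNext =>
    obtain ⟨x, h1, h2, h3, h4⟩ := H
    exact ⟨x, h1, h2, h3, List.mem_append_left _ h4⟩
  | casTail =>
    obtain ⟨x, h1, h2, h3, k, j, h4, h5, h6⟩ := H
    exact ⟨x, h1, h2, h3, k, j, h4, hat h5, hat h6⟩
  | walkBack =>
    obtain ⟨x, h1, h2, h3, k, h4, h5, h6⟩ := H
    exact ⟨x, h1, h2, h3, k, h4.trans ht, hat h5, h6⟩
  | storeData =>
    obtain ⟨x, h1, h2, h3, k, h4, h5, h6⟩ := H
    exact ⟨x, h1, h2, h3, k, h4.trans ht, hat h5, h6⟩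
  | storeSet =>
    obtain ⟨x, h1, h2, k, h4, h5, h6⟩ := H
    exact ⟨x, h1, h2, k, h4.trans ht, hat h5, h6⟩
  | preAlloc | preCasNext => exact ⟨H.1, List.mem_append_left _ H.2⟩
  | preCasTail =>
    obtain ⟨h1, k, j, h4, h5, h6⟩ := H
    exact ⟨h1, k, j, h4, hat h5, hat h6⟩

/-- Steps of the producers do not disturb the dequeue. -/
theorem DeqRel.mono {hd : ℕ} (l : List Ptr) (hcons : A'.cons = A.cons)
    (hqueue : A'.queue = A.queue) (hsnap : A'.snap = A.snap)
    (hhan : ∀ l, (A'.cell l).isSet = .handled ↔ (A.cell l).isSet = .handled)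
    {pc : DeqPC V} (H : DeqRel b hd L h A pc) : DeqRel b hd (L ++ l) h A' pc := by
  have hat : ∀ {k : ℕ} {p : Ptr}, L[k]? = some p → (L ++ l)[k]? = some p :=
    fun hk => getElem?_append_of_eq_some hk l
  have hS : ∀ {i}, Searching A i → Searching A' i := fun {i} H => by
    simpa only [Searching, hcons, hqueue, hsnap] using H
  have hH : ∀ {i j}, AllHandled A.cell i j → AllHandled A'.cell i j := fun {i j} H => by
    simpa only [AllHandled, hhan] using H
  cases pc <;> simp only [DeqRel, hcons, hqueue, ne_eq, hhan] at H ⊢ <;> try exact H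
  case scan =>
    obtain ⟨h1, h2, k, h3, h4, h5, h6⟩ := H
    exact ⟨h1, h2, k, h3, hat h4, hS h5, fun x y => hH (h6 x y)⟩
  case scanTail =>
    obtain ⟨h1, h2, k, h3, h4, h5, h6⟩ := H
    exact ⟨h1, h2, k, h3, hat h4, hS h5, fun x y => hH (h6 x y)⟩
  case scanNext =>
    obtain ⟨h1, k, h3, h4, h5⟩ := H
    exact ⟨h1, k, h3, hat h4, hS h5⟩
  case foldTail =>
    obtain ⟨h1, k, h3, h4, h5, h6⟩ := H
    exact ⟨h1, k, h3, hat h4, hS h5, hH h6⟩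
  case foldNext =>
    obtain ⟨h1, k, h3, h4, h5, h6⟩ := H
    exact ⟨h1, k, h3, hat h4, hS h5, hH h6⟩
  case foldPrev =>
    obtain ⟨h1, k, j, h2, h3, h4, h5, h6, h7⟩ := H
    exact ⟨h1, k, j, h2, h3, hat h4, hat h5, hS h6, hH h7⟩
  case foldLink =>
    obtain ⟨h1, k, j, h2, h3, h4, h5, h6, h7⟩ := H
    exact ⟨h1, k, j, h2, h3, hat h4, hat h5, hS h6, hH h7⟩
  case rescan =>
    obtain ⟨h1, h2, h3, k, j, h4, h5, h6, h7, h8⟩ := H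
    exact ⟨h1, h2, h3, k, j, h4, hat h5, hat h6, hS h7, h8⟩
  case rescanNext =>
    obtain ⟨h1, h3, k, j, h4, h5, h6, h7, h8⟩ := H
    exact ⟨h1, h3, k, j, h4, hat h5, hat h6, hS h7, h8⟩
  case loadData =>
    obtain ⟨h1, h2, j, h3, h4, h5⟩ := H
    exact ⟨h1, h2, j, hat h3, hS h4, h5⟩
  case markHandled =>
    obtain ⟨h1, h2, j, h3, h4, h5⟩ := H
    exact ⟨h1, h2, j, hat h3, hS h4, h5⟩

/-! ### Steps of the producers -/

theorem Memory.head_modify {m : Memory V} {p : Ptr} {f : BufferList V → BufferList V}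
    (hf : (f (m.heap p)).head = (m.heap p).head) : (m.modify p f).head = m.head := by
  change ((m.modify p f).heap m.headOfQueue).head = (m.heap m.headOfQueue).head
  by_cases hp : m.headOfQueue = p
  · rw [hp]; simpa [Memory.modify] using hf
  · simp [Memory.modify, hp]

theorem MemInv.head_alloc {m : Memory V} {cell : ℕ → Node V} (H : MemInv b m L cell h t)
    (p : Ptr) : (m.alloc p).head = m.head := by
  have := H.lt_fresh _ (List.mem_of_getElem? H.headOfQueue)
  simp [Memory.alloc, Memory.head, this.ne]

variable [DecidableEq P]

/-- The simulation after a step of the producer `u`, which may link the buffers `l`: the other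
producers and the consumer are not disturbed. -/
theorem Sim.of_enq {m' : Memory V} {pc' : EnqPC V} {t' : ℕ}
    (H : Sim b s A L h t) (u : P) (l : List Ptr)
    (hmem : MemInv b m' (L ++ l) A'.cell h t') (htail : A'.tail = m'.tail) (ht : t ≤ t')
    (hprod : ∀ u', u' ≠ u → A'.prod u' = A.prod u')
    (hrel : EnqRel b (L ++ l) t' (A'.prod u) pc')
    (hpriv : ∀ tmp new, IsPrivate s.mem L tmp new → (∀ q, (s.enq u).priv ≠ some (q, new)) →
      IsPrivate m' (L ++ l) tmp new)
    (hnew : ∀ tmp new, pc'.priv = some (tmp, new) →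
      IsPrivate m' (L ++ l) tmp new ∧ new = s.mem.fresh)
    (hhd : m'.head = s.mem.head)
    (hcons : A'.cons = A.cons) (hqueue : A'.queue = A.queue) (hsnap : A'.snap = A.snap)
    (hhan : ∀ l, (A'.cell l).isSet = .handled ↔ (A.cell l).isSet = .handled) :
    Sim b { s with mem := m', enq := Function.update s.enq u pc' } A' (L ++ l) h t' where
  mem := hmem
  tail := htail
  enq u' := by
    by_cases hu : u' = u
    · subst hu; simpa using hrel
    · simpa [hu, hprod u' hu] using (H.enq u').mono ht l
  priv u' tmp new hp := by
    change (Function.update s.enq u pc' u').priv = _ at hp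
    by_cases hu : u' = u
    · subst hu
      rw [Function.update_self] at hp
      exact (hnew tmp new hp).1
    · rw [Function.update_of_ne hu] at hp
      exact hpriv tmp new (H.priv u' tmp new hp) fun q hq => hu (H.priv_inj _ _ _ _ _ hp hq)
  priv_inj u₁ u₂ tmp₁ tmp₂ new h₁ h₂ := by
    change (Function.update s.enq u pc' u₁).priv = _ at h₁
    change (Function.update s.enq u pc' u₂).priv = _ at h₂
    by_cases hu₁ : u₁ = u <;> by_cases hu₂ : u₂ = u
    · rw [hu₁, hu₂]
    · rw [hu₁, Function.update_self] at h₁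
      rw [Function.update_of_ne hu₂] at h₂
      exact absurd (hnew _ _ h₁).2 (H.priv _ _ _ h₂).1.ne
    · rw [hu₂, Function.update_self] at h₂
      rw [Function.update_of_ne hu₁] at h₁
      exact absurd (hnew _ _ h₂).2 (H.priv _ _ _ h₁).1.ne
    · rw [Function.update_of_ne hu₁] at h₁
      rw [Function.update_of_ne hu₂] at h₂
      exact H.priv_inj _ _ _ _ _ h₁ h₂
  deq := by
    rw [hhd]
    exact H.deq.mono l hcons hqueue hsnap hhan

/-- A step that only reads. -/
theorem Sim.enq_read (H : Sim b s A L h t) (u : P) {pc : EnqPC V}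
    (hrel : EnqRel b L t (A.prod u) pc) (hpc : pc.priv = none) :
    Sim b { s with enq := Function.update s.enq u pc } A L h t := by
  have := H.of_enq (A' := A) (m' := s.mem) (t' := t) u [] (by simpa using H.mem) H.tail le_rfl
    (fun _ _ => rfl) (by simpa using hrel) (fun _ _ hp _ => by simpa using hp)
    (by simp [hpc]) rfl rfl rfl rfl (fun _ => Iff.rfl)
  simpa using this

/-- The step that allocates a buffer. -/
theorem Sim.enq_alloc (H : Sim b s A L h t) (u : P) {pc : EnqPC V} {tmp : Ptr} (htmp : tmp ∈ L)
    (hrel : EnqRel b L t (A.prod u) pc) (hpc : pc.priv = some (tmp, s.mem.fresh)) :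
    Sim b { s with mem := s.mem.alloc tmp, enq := Function.update s.enq u pc } A L h t := by
  have := H.of_enq (A' := A) (m' := s.mem.alloc tmp) (t' := t) u []
    (by simpa using H.mem.alloc tmp) H.tail le_rfl
    (fun _ _ => rfl) (by simpa using hrel) (fun _ _ hp _ => by simpa using hp.alloc tmp)
    (by
      rw [hpc]
      rintro _ _ ⟨⟩
      simpa using H.mem.isPrivate_alloc htmp)
    (H.mem.head_alloc tmp) rfl rfl rfl (fun _ => Iff.rfl)
  simpa using this

/-- A successful CAS on `next`. -/
theorem Sim.enq_link (H : Sim b s A L h t) (u : P) {pc : EnqPC V} {tmp new : Ptr}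
    (hpriv : (s.enq u).priv = some (tmp, new)) (hnone : (s.mem.heap tmp).next = none)
    (hrel : (∃ k j : ℕ, k < j ∧ (L ++ [new])[k]? = some tmp ∧ (L ++ [new])[j]? = some new) →
      EnqRel b (L ++ [new]) t (A.prod u) pc) (hpc : pc.priv = none) :
    Sim b { s with
      mem := s.mem.modify tmp fun B => { B with next := some new }
      enq := Function.update s.enq u pc } A (L ++ [new]) h t := by
  have hp := H.priv u tmp new hpriv
  obtain ⟨hmem, k, hk, hj⟩ := H.mem.link hp hnone
  refine H.of_enq u [new] hmem H.tail le_rfl (fun _ _ => rfl)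
    (hrel ⟨k, k + 1, Nat.lt_succ_self _, getElem?_append_of_eq_some hk _, hj⟩) ?_
    (by simp [hpc]) (Memory.head_modify rfl) rfl rfl rfl (fun _ => Iff.rfl)
  intro tmp' new' hp' hne
  refine (hp'.modify (List.mem_of_getElem? hk) _).append ?_
  rintro rfl
  exact hne tmp hpriv

/-- A successful CAS on `tailOfQueue`. -/
theorem Sim.enq_moveTail (H : Sim b s A L h t) (u : P) {pc : EnqPC V} {tmp new : Ptr}
    (hidx : ∃ k j : ℕ, k < j ∧ L[k]? = some tmp ∧ L[j]? = some new) (htmp : s.mem.tailOfQueue = tmp)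
    (hrel : ∀ t, EnqRel b L t (A.prod u) pc) (hpc : pc.priv = none) :
    ∃ t', Sim b { s with
      mem := { s.mem with tailOfQueue := new }
      enq := Function.update s.enq u pc } A L h t' := by
  obtain ⟨k, j, hkj, hk, hj⟩ := hidx
  obtain rfl : k = t := H.mem.index_inj hk (htmp ▸ H.mem.tailOfQueue)
  have := H.of_enq (A' := A) (m' := { s.mem with tailOfQueue := new }) (t' := j) u []
    (by simpa using H.mem.moveTail hj hkj.le) H.tail hkj.le
    (fun _ _ => rfl) (by simpa using hrel j) (fun _ _ hp _ => by rw [List.append_nil]; exact hp)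
    (by simp [hpc]) rfl rfl rfl rfl (fun _ => Iff.rfl)
  exact ⟨j, by simpa using this⟩

theorem Sim.enq_step (H : Sim b s A L h t) (hA : A.Inv) (u : P) {m' : Memory V} {pc' : EnqPC V}
    (hs : enqStep b s.mem (s.enq u) = some (m', pc')) :
    ∃ A' L' t', A'.hist = A.hist ∧ A'.Inv ∧
      Sim b { s with mem := m', enq := Function.update s.enq u pc' } A' L' h t' := by
  have hr := H.enq u
  have hv := hA.prod u
  cases hpc : s.enq u with
  | idle => rw [hpc] at hs; cases hs
  | fetchAdd v =>
    rw [hpc] at hs hr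
    obtain ⟨i, hst⟩ := hr
    cases hs
    refine ⟨_, L ++ [], t, ?_, hA.fetchAdd u i v hst, H.of_enq u [] ?_ ?_ le_rfl ?_ ?_ ?_ ?_
      ?_ ?_ ?_ ?_ ?_⟩
    · rfl
    · exact { (by simpa using H.mem : MemInv b s.mem (L ++ []) A.cell h t) with }
    · exact congrArg (· + 1) H.tail
    · intro u' hu'; simp [hu']
    · exact ⟨_, Function.update_self .., rfl, H.tail.symm⟩
    · intro tmp new hp _; rw [List.append_nil]; exact hp
    · simp [EnqPC.priv]
    · rfl
    · rfl
    · rfl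
    · rfl
    · exact fun _ => Iff.rfl
  | loadTail v loc =>
    rw [hpc] at hs hr
    obtain ⟨x, hst, hx, hloc⟩ := hr
    rw [enqStep, H.mem.pos t _ H.mem.tailOfQueue] at hs
    split_ifs at hs with hle
    · cases hs
      exact ⟨A, L, t, rfl, hA,
        H.enq_read u ⟨x, hst, hx, hloc, List.mem_of_getElem? H.mem.tailOfQueue⟩ rfl⟩
    · cases hs
      exact ⟨A, L, t, rfl, hA,
        H.enq_read u ⟨x, hst, hx, hloc, t, le_rfl, H.mem.tailOfQueue, not_le.1 hle⟩ rfl⟩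
  | loadNext v loc tmp =>
    rw [hpc] at hs hr
    obtain ⟨x, hst, hx, hloc, htmp⟩ := hr
    rw [enqStep] at hs
    split at hs
    · rename_i nxt hn
      cases hs
      obtain ⟨k, hk⟩ := List.mem_iff_getElem?.1 htmp
      obtain ⟨j, hkj, hj, -⟩ := H.mem.next_some k tmp nxt hk hn
      exact ⟨A, L, t, rfl, hA, H.enq_read u ⟨x, hst, hx, hloc, k, j, hkj, hk, hj⟩ rfl⟩
    · cases hs
      exact ⟨A, L, t, rfl, hA, H.enq_alloc u htmp ⟨x, hst, hx, hloc, htmp⟩ rfl⟩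
  | casNext v loc tmp new =>
    have hpriv : (s.enq u).priv = some (tmp, new) := by rw [hpc]; rfl
    rw [hpc] at hs hr
    obtain ⟨x, hst, hx, hloc, htmp⟩ := hr
    rw [enqStep] at hs
    split_ifs at hs with hn
    · cases hs
      exact ⟨A, _, t, rfl, hA, H.enq_link u hpriv hn (fun hi => ⟨x, hst, hx, hloc, hi⟩) rfl⟩
    · cases hs
      exact ⟨A, L, t, rfl, hA, H.enq_read u ⟨x, hst, hx, hloc⟩ rfl⟩
  | casTail v loc tmp new =>
    rw [hpc] at hs hr
    obtain ⟨x, hst, hx, hloc, hi⟩ := hr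
    rw [enqStep] at hs
    split_ifs at hs with ht
    · cases hs
      obtain ⟨t', h'⟩ := H.enq_moveTail u (pc := .loadTail v loc) hi ht
        (fun _ => ⟨x, hst, hx, hloc⟩) rfl
      exact ⟨A, L, t', rfl, hA, h'⟩
    · cases hs
      exact ⟨A, L, t, rfl, hA, H.enq_read u ⟨x, hst, hx, hloc⟩ rfl⟩
  | walkBack v loc tmp last =>
    rw [hpc] at hs hr
    obtain ⟨x, hst, hx, hloc, k, hkt, hk, hlt⟩ := hr
    rw [enqStep, H.mem.prevSize hk] at hs
    split_ifs at hs with hlt'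
    · split at hs
      · rename_i p hp
        cases hs
        obtain ⟨j, hjk, hj, hh⟩ := H.mem.prev_some k tmp p hk hp
        refine ⟨A, L, t, rfl, hA,
          H.enq_read u ⟨x, hst, hx, hloc, j, by omega, hj, ?_⟩ rfl⟩
        -- the cell of this enqueue is still `empty`, so it is not in a buffer that is skipped
        by_contra hge
        rw [hst] at hv
        have h1 := hh loc (not_lt.1 hge) hlt'
        rw [hloc, hv.2.2.2] at h1
        cases h1
      · cases hs
    · cases hs
      exact ⟨A, L, t, rfl, hA,
        H.enq_read u ⟨x, hst, hx, hloc, k, hkt, hk, not_lt.1 hlt', hlt⟩ rfl⟩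
  | storeData v loc tmp last =>
    rw [hpc] at hs hr
    obtain ⟨x, hst, rfl, rfl, k, hkt, hk, hle, hlt⟩ := hr
    rw [enqStep, H.mem.prevSize hk] at hs
    cases hs
    rw [hst] at hv
    rw [Nat.mul_succ] at hlt
    have hm := H.mem.modifyNode hk (i := x.loc - b * k) (by omega) hkt
      (fun n => { n with data := some x.val }) id
    have hadd : b * k + (x.loc - b * k) = x.loc := by omega
    rw [hadd] at hm
    refine ⟨_, L ++ [], t, ?_, hA.storeData u x hst, H.of_enq u [] ?_ ?_ le_rfl ?_ ?_ ?_ ?_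
      ?_ ?_ ?_ ?_ ?_⟩
    · rfl
    · rw [List.append_nil]; exact hm
    · exact H.tail
    · intro u' hu'; simp [hu']
    · exact ⟨x, by simp, rfl, k, hkt, by simpa using hk, hle, by rw [Nat.mul_succ]; exact hlt⟩
    · intro tmp' new hp _
      rw [List.append_nil]
      exact hp.modify (List.mem_of_getElem? hk) _
    · simp [EnqPC.priv]
    · exact Memory.head_modify rfl
    · rfl
    · rfl
    · rfl
    · intro l
      by_cases hl : l = x.loc
      · subst hl; simp
      · simp [hl]
  | storeSet loc tmp last =>
    rw [hpc] at hs hr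
    obtain ⟨x, hst, rfl, k, hkt, hk, hle, hlt⟩ := hr
    rw [enqStep, H.mem.prevSize hk] at hs
    cases hs
    rw [hst] at hv
    rw [Nat.mul_succ] at hlt
    have hempty := hv.2.2.2.1
    have hadd : b * k + (x.loc - b * k) = x.loc := by omega
    have hm := H.mem.modifyNode hk (i := x.loc - b * k) (by omega) hkt
      (fun n => { n with isSet := .set }) (by rw [hadd, hempty]; simp)
    rw [hadd] at hm
    refine ⟨_, L ++ [], t, ?_, hA.storeSet u x hst, H.of_enq u [] ?_ ?_ le_rfl ?_ ?_ ?_ ?_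
      ?_ ?_ ?_ ?_ ?_⟩
    · rfl
    · rw [List.append_nil]; exact hm
    · exact H.tail
    · intro u' hu'; simp [hu']
    · split_ifs
      · exact ⟨⟨x, by simp⟩, by simpa using List.mem_of_getElem? hk⟩
      · exact ⟨x, by simp⟩
    · intro tmp' new hp _
      rw [List.append_nil]
      exact hp.modify (List.mem_of_getElem? hk) _
    · split_ifs <;> simp [EnqPC.priv]
    · exact Memory.head_modify rfl
    · rfl
    · rfl
    · rfl
    · intro l
      by_cases hl : l = x.loc
      · subst hl; simp [hempty]
      · simp [hl]
  | preAlloc tmp =>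
    rw [hpc] at hs hr
    cases hs
    exact ⟨A, L, t, rfl, hA, H.enq_alloc u hr.2 hr rfl⟩
  | preCasNext tmp new =>
    have hpriv : (s.enq u).priv = some (tmp, new) := by rw [hpc]; rfl
    rw [hpc] at hs hr
    rw [enqStep] at hs
    split_ifs at hs with hn
    · cases hs
      exact ⟨A, _, t, rfl, hA, H.enq_link u hpriv hn (fun hi => ⟨hr.1, hi⟩) rfl⟩
    · cases hs
      exact ⟨A, L, t, rfl, hA, H.enq_read u hr.1 rfl⟩
  | preCasTail tmp new =>
    rw [hpc] at hs hr
    rw [enqStep] at hs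
    split_ifs at hs with ht
    · cases hs
      obtain ⟨t', h'⟩ := H.enq_moveTail u (pc := .ret) hr.2 ht (fun _ => hr.1) rfl
      exact ⟨A, L, t', rfl, hA, h'⟩
    · cases hs
      exact ⟨A, L, t, rfl, hA, H.enq_read u hr.1 rfl⟩
  | ret => rw [hpc] at hs; cases hs

end Sim

/-! ### Steps of the consumer -/

section Consumer

variable {P V : Type*} {b : ℕ} {s : State P V} {A A' : Abs P V} {L : List Ptr} {h t : ℕ}

/-- The simulation after a step of the consumer. -/
theorem Sim.of_deq {m' : Memory V} {pc' : DeqPC V} {h' : ℕ} (H : Sim b s A L h t)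
    (hmem : MemInv b m' L A'.cell h' t) (htail : A'.tail = A.tail) (htail' : m'.tail = s.mem.tail)
    (hprod : A'.prod = A.prod)
    (hpriv : ∀ tmp new, IsPrivate s.mem L tmp new → IsPrivate m' L tmp new)
    (hdeq : DeqRel b m'.head L h' A' pc') :
    Sim b { s with mem := m', deq := pc' } A' L h' t where
  mem := hmem
  tail := htail.trans (H.tail.trans htail'.symm)
  enq u := by rw [hprod]; exact H.enq u
  priv u tmp new hp := hpriv tmp new (H.priv u tmp new hp)
  priv_inj := H.priv_inj
  deq := hdeq

/-- The outcome of a step of the consumer that leads to the memory `m` and the local state `pc`. -/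
def DeqGoal (b : ℕ) (s : State P V) (A : Abs P V) (L : List Ptr) (t : ℕ) (m : Memory V)
    (pc : DeqPC V) : Prop :=
  ∃ A' h', A'.hist = A.hist ∧ A'.Inv ∧ Sim b { s with mem := m, deq := pc } A' L h' t

/-- A step that only reads. -/
theorem Sim.deq_read (H : Sim b s A L h t) (hA : A.Inv) {pc : DeqPC V}
    (hpc : DeqRel b s.mem.head L h A pc) : DeqGoal b s A L t s.mem pc :=
  ⟨A, h, rfl, hA, H.of_deq H.mem rfl rfl rfl (fun _ _ => id) hpc⟩

/-- A step at which a snapshot is taken. -/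
theorem Sim.deq_snapshot (H : Sim b s A L h t) (hA : A.Inv) {pc : DeqPC V}
    (hpc : ∀ A' : Abs P V, A'.Inv → A'.cell = A.cell → A'.cons = A.cons →
      A'.snap = A.hist.length → A'.fresh = [] → DeqRel b s.mem.head L h A' pc) :
    DeqGoal b s A L t s.mem pc := by
  obtain ⟨S, Q, hA'⟩ := hA.snapshot
  refine ⟨_, h, ?_, hA',
    H.of_deq H.mem rfl rfl rfl (fun _ _ => id) (hpc _ hA' rfl rfl rfl rfl)⟩
  rfl

theorem Abs.Inv.lt_length (hA : A.Inv) {i : ℕ} (hc : A.cons = .active i) : i < A.hist.length := by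
  have := hA.cons
  rw [hc] at this
  exact this.1.lt_length

/-- A dequeue returns `false` because nothing was set when it took its snapshot. -/
theorem Sim.deq_empty (H : Sim b s A L h t) (hA : A.Inv) {l : ℕ} (hS : Searching A l)
    (hl : ∀ x ∈ A.queue, x.loc < l) : DeqGoal b s A L t s.mem (.ret .retFalse) := by
  obtain ⟨⟨i, hc, hi⟩, hQ⟩ := hS
  have hempty : A.queue = [] :=
    List.eq_nil_iff_forall_not_mem.2 fun x hx => absurd (hl x hx) (not_lt.2 (hQ x hx))
  refine ⟨_, h, ?_, hA.commitEmpty i hc hi hempty,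
    H.of_deq H.mem rfl rfl rfl (fun _ _ => id) ⟨i, rfl⟩⟩
  rfl

/-- A dequeue returns `false` because nothing is set right now. -/
theorem Sim.deq_empty_now (H : Sim b s A L h t) (hA : A.Inv) (hc : ∃ i, A.cons = .active i)
    (hempty : ∀ l, (A.cell l).isSet ≠ .set) : DeqGoal b s A L t s.mem (.ret .retFalse) := by
  obtain ⟨i, hc⟩ := hc
  obtain ⟨S, Q, hA'⟩ := hA.snapshot
  have hQ : Q = [] := List.eq_nil_iff_forall_not_mem.2 fun x hx => hempty x.loc (hA'.queue_set hx)
  refine ⟨_, h, ?_, hA'.commitEmpty i hc (hA.lt_length hc) hQ,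
    H.of_deq H.mem rfl rfl rfl (fun _ _ => id) ⟨i, rfl⟩⟩
  rfl

theorem Searching.mono {l r : ℕ} (H : Searching A l)
    (hr : ∀ x ∈ A.queue, l ≤ x.loc → r ≤ x.loc) : Searching A r :=
  ⟨H.1, fun x hx => hr x hx (H.2 x hx)⟩

theorem Searching.succ (hA : A.Inv) {l : ℕ} (H : Searching A l) (hl : (A.cell l).isSet ≠ .set) :
    Searching A (l + 1) :=
  H.mono fun x hx hle => Nat.succ_le_of_lt <| lt_of_le_of_ne hle <| by
    rintro rfl
    exact hl (hA.queue_set hx)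

theorem Searching.skip (hA : A.Inv) {l r : ℕ} (H : Searching A l) (hlr : AllHandled A.cell l r) :
    Searching A r :=
  H.mono fun x hx hle => by
    by_contra hlt
    have := hlr x.loc hle (not_le.1 hlt)
    rw [hA.queue_set hx] at this
    cases this

/-- After a snapshot, everything that was set is at the location of `headOfQueue` and its `head`
or later. -/
theorem MemInv.searching {m : Memory V} (H : MemInv b m L A.cell h t) (hA : A.Inv) {i : ℕ}
    (hc : A.cons = .active i) (hi : i < A.snap) : Searching A (b * h + m.head) := by
  refine ⟨⟨i, hc, hi⟩, fun x hx => ?_⟩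
  by_contra hlt
  have := H.handled x.loc (not_le.1 hlt)
  rw [hA.queue_set hx] at this
  cases this

theorem MemInv.queue_lt {m : Memory V} (H : MemInv b m L A.cell h t) (hA : A.Inv)
    {x : Ticket P V} (hx : x ∈ A.queue) {k : ℕ} (hk : t ≤ k) : x.loc < b * (k + 1) :=
  (H.lt_tail x.loc (hA.queue_mem hx).2.1).trans_le (Nat.mul_le_mul_left _ (by omega))

/-- Nothing is set when the buffer `headOfQueue` has been read to the end and producers have not
written beyond it. -/
theorem MemInv.not_set {m : Memory V} {cell : ℕ → Node V} (H : MemInv b m L cell h t)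
    (hb : b ≤ m.head) (hth : t ≤ h) (l : ℕ) : (cell l).isSet ≠ .set := by
  intro hl
  have h1 := H.lt_tail l (by rw [hl]; simp)
  have h2 : b * (t + 1) ≤ b * (h + 1) := Nat.mul_le_mul_left _ (by omega)
  rw [Nat.mul_succ b h] at h2
  have h3 := H.handled l (by omega)
  rw [hl] at h3
  cases h3

/-- A `set` element `e` has been selected: a snapshot is taken, and the check for earlier elements
starts at the location of `headOfQueue` and its `head`. -/
theorem Sim.deq_rescan (H : Sim b s A L h t) (hA : A.Inv) (hc : ∃ i, A.cons = .active i)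
    (hd : s.mem.head < b) {e : Ptr × ℕ} {k : ℕ} (hk : L[k]? = some e.1) (he : e.2 < b)
    (hset : (A.cell (b * k + e.2)).isSet = .set) :
    DeqGoal b s A L t s.mem (.rescan (s.mem.headOfQueue, s.mem.head) e) := by
  obtain ⟨i, hc⟩ := hc
  refine H.deq_snapshot hA fun A' hA' hcell hcons hsnap hfresh => ?_
  have hmem : MemInv b s.mem L A'.cell h t := hcell ▸ H.mem
  rw [← hcell] at hset
  obtain ⟨x, hx, hxl⟩ := (hA'.set_iff _).1 hset
  rw [hfresh] at hx
  exact ⟨hd, hd, he, h, k, le_rfl, H.mem.headOfQueue, hk,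
    hmem.searching hA' (hcons.trans hc) (hsnap ▸ hA.lt_length hc), x,
    hx.resolve_right (by simp), hxl⟩

/-- The step that marks the selected element as handled. -/
theorem Sim.deq_mark (H : Sim b s A L h t) (hA : A.Inv) {p : Ptr} {i j : ℕ}
    (hd : s.mem.head < b) (hi : i < b) (hj : L[j]? = some p) (hS : Searching A 0)
    {x : Ticket P V} {Q : List (Ticket P V)} (hQ : A.queue = x :: Q) (hx : x.loc = b * j + i)
    {m' : Memory V} {pc' : DeqPC V}
    (hs : deqStep b s.mem (.markHandled (p, i) (some x.val)) = some (m', pc')) :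
    DeqGoal b s A L t m' pc' := by
  obtain ⟨⟨o, hc, ho⟩, -⟩ := hS
  have hA' := hA.commitDequeue o hc ho x Q hQ
  have hxQ : x ∈ A.queue := by simp [hQ]
  have hset := hA.queue_set hxQ
  have hjt : j ≤ t := by
    by_contra hlt
    have h1 := H.mem.queue_lt hA hxQ le_rfl
    have h2 : b * (t + 1) ≤ b * j := Nat.mul_le_mul_left _ (by omega)
    omega
  have hm := H.mem.modifyNode hj hi hjt (fun n => { n with isSet := .handled }) fun _ => rfl
  rw [← hx] at hm
  have hhd : (s.mem.modifyNode p i fun n => { n with isSet := .handled }).head = s.mem.head :=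
    Memory.head_modify rfl
  simp only [deqStep] at hs
  split_ifs at hs with hn hlast <;> obtain ⟨rfl, rfl⟩ := Prod.mk.inj (Option.some.inj hs)
  -- the first element is removed, at the end of the buffer, and elsewhere
  iterate 2
    simp only [Prod.mk.injEq] at hn
    obtain ⟨rfl, rfl⟩ := hn
    obtain rfl := H.mem.index_inj hj H.mem.headOfQueue
    have hm' := hm.advanceHead (by rw [hhd]; exact hd) (by rw [hhd, ← hx]; simp)
    refine ⟨_, j, ?_, hA', H.of_deq hm' ?_ ?_ ?_ (fun tmp new hp =>
      (hp.modify (List.mem_of_getElem? hj) _).modify (List.mem_of_getElem? hj) _) ?_⟩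
    · rfl
    · rfl
    · rfl
    · rfl
    · rw [Memory.head_advanceHead, hhd]
      first
        | exact ⟨⟨o, rfl⟩, hlast⟩
        | exact ⟨o, rfl⟩
  -- another element is removed
  · refine ⟨_, h, ?_, hA', H.of_deq hm ?_ ?_ ?_ (fun tmp new hp =>
      hp.modify (List.mem_of_getElem? hj) _) ⟨o, rfl⟩⟩ <;> rfl

theorem Sim.deq_step (hb : 0 < b) (H : Sim b s A L h t) (hA : A.Inv) {m' : Memory V}
    {pc' : DeqPC V} (hs : deqStep b s.mem s.deq = some (m', pc')) : DeqGoal b s A L t m' pc' := by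
  have hr := H.deq
  cases hpc : s.deq with
  | idle => rw [hpc] at hs; cases hs
  | skip =>
    rw [hpc] at hs hr
    rw [deqStep] at hs
    split_ifs at hs with hle hn
    · cases hs
      exact H.deq_read hA ⟨hr, hle⟩
    · cases hs
      rw [not_le] at hle
      rw [H.mem.head_node hle] at hn
      exact ⟨A, h, rfl, hA, H.of_deq (H.mem.advanceHead hle hn) rfl rfl rfl
        (fun _ _ hp => hp.modify (List.mem_of_getElem? H.mem.headOfQueue) _) hr⟩
    · cases hs
      rw [not_le] at hle
      rw [H.mem.head_node hle] at hn
      exact H.deq_read hA ⟨hr, hle, hn⟩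
  | skipMoveTail =>
    rw [hpc] at hs hr
    rw [deqStep] at hs
    split_ifs at hs with ht
    · cases hs
      have := H.mem.tailOfQueue
      rw [← ht] at this
      exact H.deq_empty_now hA hr.1 (H.mem.not_set hr.2 (H.mem.index_inj this H.mem.headOfQueue).le)
    · cases hs
      exact H.deq_read hA hr
  | skipMoveNext =>
    rw [hpc] at hs hr
    rw [deqStep] at hs
    split at hs
    · rename_i hn
      cases hs
      have h1 := H.mem.next_none h _ H.mem.headOfQueue hn
      have h2 := H.mem.tail_lt_length
      exact H.deq_empty_now hA hr.1 (H.mem.not_set hr.2 (by omega))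
    · rename_i nxt hn
      cases hs
      obtain ⟨h', hm⟩ := H.mem.moveHead hr.2 hn
      exact ⟨A, h', rfl, hA, H.of_deq hm rfl rfl rfl (fun _ _ hp => hp) hr.1⟩
  | checkEmpty =>
    rw [hpc] at hs hr
    rw [deqStep, H.mem.prevSize H.mem.headOfQueue] at hs
    split_ifs at hs with ht
    · cases hs
      refine H.deq_empty_now hA hr.1 fun l hl => ?_
      have h1 := hA.lt_tail l (by rw [hl]; simp)
      rw [H.tail, ← ht] at h1
      have h2 := H.mem.handled l h1
      rw [hl] at h2
      cases h2
    · cases hs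
      exact H.deq_read hA hr
  | checkFirst =>
    rw [hpc] at hs hr
    obtain ⟨⟨i, hc⟩, hd, hn⟩ := hr
    rw [deqStep, H.mem.head_node hd] at hs
    split_ifs at hs with he
    · cases hs
      refine H.deq_snapshot hA fun A' hA' hcell hcons hsnap _ => ?_
      have hmem : MemInv b s.mem L A'.cell h t := hcell ▸ H.mem
      exact ⟨hd, hd, h, le_rfl, H.mem.headOfQueue,
        hmem.searching hA' (hcons.trans hc) (hsnap ▸ hA.lt_length hc),
        fun _ hh => absurd hh (lt_irrefl _)⟩
    · cases hs
      refine H.deq_rescan hA ⟨i, hc⟩ hd H.mem.headOfQueue hd ?_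
      change (A.cell (b * h + s.mem.head)).isSet = .set
      cases hf : (A.cell (b * h + s.mem.head)).isSet with
      | empty => exact absurd hf he
      | set => rfl
      | handled => exact absurd hf hn
  | scan p i all =>
    rw [hpc] at hs hr
    obtain ⟨hd, hi, k, hhk, hk, hS, hall⟩ := hr
    rw [deqStep, H.mem.node_eq hk hi] at hs
    split_ifs at hs with hset
    · cases hs
      exact H.deq_rescan hA (hS.1.imp fun _ => And.left) hd hk hi hset
    · cases hs
      refine H.deq_read hA ⟨hd, hi, k, hhk, hk, hS.succ hA hset, fun ha hlt l h1 h2 => ?_⟩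
      simp only [Bool.and_eq_true, decide_eq_true_eq] at ha
      rcases Nat.lt_succ_iff_lt_or_eq.1 h2 with h2 | rfl
      · exact hall ha.1 hlt l h1 h2
      · exact ha.2
  | scanTail p i all =>
    rw [hpc] at hs hr
    obtain ⟨hd, hi, k, hhk, hk, hS, hall⟩ := hr
    rw [deqStep, H.mem.prevSize hk] at hs
    split_ifs at hs with ht hi' ha
    · cases hs
      refine H.deq_empty hA hS fun x hx => ?_
      have := hA.loc_lt x (hA.queue_mem hx).1
      rw [H.tail] at this
      omega
    · cases hs
      exact H.deq_read hA ⟨hd, hi', k, hhk, hk, hS, hall⟩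
    · cases hs
      have he : b * k + i + 1 = b * (k + 1) := by rw [Nat.mul_succ]; omega
      rw [he] at hS hall
      have hne : h ≠ k := by
        rintro rfl
        have := H.mem.headOfQueue
        rw [hk] at this
        exact ha.2 (by simpa using this)
      have hlt : h < k := by omega
      exact H.deq_read hA ⟨hd, k, hlt, hk, hS, hall ha.1 hlt⟩
    · cases hs
      have he : b * k + i + 1 = b * (k + 1) := by rw [Nat.mul_succ]; omega
      rw [he] at hS
      exact H.deq_read hA ⟨hd, k, hhk, hk, hS⟩
  | scanNext p =>
    rw [hpc] at hs hr
    obtain ⟨hd, k, hhk, hk, hS⟩ := hr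
    rw [deqStep] at hs
    split at hs
    · rename_i hn
      cases hs
      have h1 := H.mem.next_none k p hk hn
      have h2 := H.mem.tail_lt_length
      exact H.deq_empty hA hS fun x hx => H.mem.queue_lt hA hx (by omega)
    · rename_i nxt hn
      cases hs
      obtain ⟨j, hkj, hj, hh⟩ := H.mem.next_some k p nxt hk hn
      rw [H.mem.head_eq_zero j nxt hj (by omega)]
      exact H.deq_read hA ⟨hd, hb, j, by omega, hj, hS.skip hA hh,
        fun _ _ l h1 h2 => absurd h2 (not_lt.2 h1)⟩
  | foldTail p =>
    rw [hpc] at hs hr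
    rw [deqStep] at hs
    split_ifs at hs with ht
    · cases hs
      obtain ⟨hd, k, hhk, hk, hS, -⟩ := hr
      have := H.mem.tailOfQueue
      rw [← ht] at this
      exact H.deq_empty hA hS fun x hx => H.mem.queue_lt hA hx (H.mem.index_inj this hk).le
    · cases hs
      exact H.deq_read hA hr
  | foldNext p =>
    rw [hpc] at hs hr
    obtain ⟨hd, k, hhk, hk, hS, hH⟩ := hr
    rw [deqStep] at hs
    split at hs
    · rename_i hn
      cases hs
      have h1 := H.mem.next_none k p hk hn
      have h2 := H.mem.tail_lt_length
      exact H.deq_empty hA hS fun x hx => H.mem.queue_lt hA hx (by omega)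
    · rename_i nxt hn
      cases hs
      obtain ⟨j, hkj, hj, hh⟩ := H.mem.next_some k p nxt hk hn
      refine H.deq_read hA ⟨hd, k, j, hhk, hkj, hk, hj, hS.skip hA hh, fun l h1 h2 => ?_⟩
      by_cases hl : l < b * (k + 1)
      · exact hH l h1 hl
      · exact hh l (not_lt.1 hl) h2
  | foldPrev p nxt =>
    rw [hpc] at hs hr
    obtain ⟨hd, k, j, hhk, hkj, hk, hj, hS, hH⟩ := hr
    rw [deqStep] at hs
    split at hs
    · cases hs
    · rename_i prv hp
      cases hs
      obtain ⟨a, hak, ha, hh⟩ := H.mem.prev_some k p prv hk hp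
      have hH' : AllHandled A.cell (b * (a + 1)) (b * j) := fun l h1 h2 => by
        by_cases hl : l < b * k
        · exact hh l h1 hl
        · exact hH l (not_lt.1 hl) h2
      have hm := H.mem.modify_pointers hj (fun B => { B with prev := some prv }) rfl rfl rfl id
        (fun q => H.mem.next_some j nxt q hj) (by
          rintro q ⟨⟩
          exact ⟨a, by omega, ha, hH'⟩)
      refine ⟨A, h, rfl, hA, H.of_deq hm rfl rfl rfl
        (fun _ _ hp => hp.modify (List.mem_of_getElem? hj) _) ?_⟩
      rw [Memory.head_modify (by rfl)]
      exact ⟨hd, a, j, by omega, by omega, ha, hj, hS, hH'⟩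
  | foldLink prv nxt =>
    rw [hpc] at hs hr
    obtain ⟨hd, k, j, hhj, hkj, hk, hj, hS, hH⟩ := hr
    rw [deqStep] at hs
    cases hs
    have hm := H.mem.modify_pointers hk (fun B => { B with next := some nxt }) rfl rfl rfl
      (by rintro ⟨⟩)
      (by
        rintro q ⟨⟩
        exact ⟨j, hkj, hj, hH⟩)
      (fun q => H.mem.prev_some k prv q hk)
    refine ⟨A, h, rfl, hA, H.of_deq hm rfl rfl rfl
      (fun _ _ hp => hp.modify (List.mem_of_getElem? hk) _) ?_⟩
    rw [Memory.head_modify (by rfl), H.mem.head_eq_zero j nxt hj hhj]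
    exact ⟨hd, hb, j, hhj.le, hj, hS, fun _ _ l h1 h2 => absurd h2 (not_lt.2 h1)⟩
  | rescan e tempN =>
    rw [hpc] at hs hr
    obtain ⟨hd, he, hn, k, j, hhk, hk, hj, hS, x, hx, hxl⟩ := hr
    rw [deqStep, H.mem.node_eq hk he] at hs
    split_ifs at hs with heq hset hlt
    · cases hs
      subst heq
      obtain rfl := H.mem.index_inj hk hj
      refine H.deq_read hA ⟨hd, he, k, hk, ⟨hS.1, fun _ _ => Nat.zero_le _⟩, ?_⟩
      -- nothing was set before `tempN`, so it is the first element of the queue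
      cases hQ : A.queue with
      | nil => simp [hQ] at hx
      | cons y Q =>
        refine ⟨y, Q, rfl, ?_⟩
        rw [hQ] at hx
        rcases List.mem_cons.1 hx with rfl | hx
        · exact hxl
        · have h1 := hA.witness.sorted
          rw [hQ] at h1
          have h2 := (List.pairwise_cons.1 h1).1 x hx
          have h3 := hS.2 y (by simp [hQ])
          omega
    · cases hs
      exact H.deq_rescan hA (hS.1.imp fun _ => And.left) hd hk he hset
    · cases hs
      exact H.deq_read hA ⟨hd, hlt, hn, k, j, hhk, hk, hj, hS.succ hA hset, x, hx, hxl⟩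
    · cases hs
      have hS' := hS.succ hA hset
      have h1 : b * k + e.2 + 1 = b * (k + 1) := by rw [Nat.mul_succ]; omega
      rw [h1] at hS'
      exact H.deq_read hA ⟨hd, hn, k, j, hhk, hk, hj, hS', x, hx, hxl⟩
  | rescanNext p tempN =>
    rw [hpc] at hs hr
    obtain ⟨hd, hn, k, j, hhk, hk, hj, hS, hx⟩ := hr
    rw [deqStep] at hs
    split at hs
    · cases hs
    · rename_i nxt hnxt
      cases hs
      obtain ⟨a, hka, ha, hh⟩ := H.mem.next_some k p nxt hk hnxt
      rw [H.mem.head_eq_zero a nxt ha (by omega)]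
      exact H.deq_read hA ⟨hd, hb, hn, a, j, by omega, ha, hj, hS.skip hA hh, hx⟩
  | loadData tempN =>
    rw [hpc] at hs hr
    obtain ⟨hd, hn, j, hj, hS, x, Q, hQ, hx⟩ := hr
    rw [deqStep, H.mem.node_eq hj hn] at hs
    cases hs
    refine H.deq_read hA ⟨hd, hn, j, hj, hS, x, Q, hQ, hx, ?_⟩
    have hxQ : x ∈ A.queue := by simp [hQ]
    rw [← hx]
    exact (hA.nonempty x (hA.queue_mem hxQ).1 (hA.queue_mem hxQ).2.1).1
  | markHandled tempN data =>
    rw [hpc] at hs hr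
    obtain ⟨hd, hn, j, hj, hS, x, Q, hQ, hx, rfl⟩ := hr
    exact H.deq_mark hA hd hn hj hS hQ hx hs
  | moveTail data =>
    rw [hpc] at hs hr
    rw [deqStep] at hs
    split_ifs at hs with ht
    · cases hs
      exact H.deq_read hA hr.1
    · cases hs
      exact H.deq_read hA hr
  | moveNext data =>
    rw [hpc] at hs hr
    rw [deqStep] at hs
    split at hs
    · cases hs
      exact H.deq_read hA hr.1
    · rename_i nxt hn
      cases hs
      obtain ⟨h', hm⟩ := H.mem.moveHead hr.2 hn
      exact ⟨A, h', rfl, hA, H.of_deq hm rfl rfl rfl (fun _ _ hp => hp) hr.1⟩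
  | ret r => rw [hpc] at hs; cases hs

end Consumer

/-! ### Executions -/

theorem sim_init (P V : Type*) (b : ℕ) : Sim b (State.init P V) (Abs.init P V) [0] 0 0 where
  mem := memInv_init V b
  tail := rfl
  enq _ := rfl
  priv u tmp new h := by cases h
  priv_inj u u' tmp tmp' new h := by cases h
  deq := rfl

/-- Every reachable state is represented by an abstract queue that has the same history. -/
theorem Reaches.exists_sim {P V : Type*} [DecidableEq P] {b : ℕ} (hb : 0 < b)
    {σ : List (Event P V)} {s : State P V} (H : Reaches b σ s) :
    ∃ A L h t, A.hist = σ ∧ A.Inv ∧ Sim b s A L h t := by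
  induction H with
  | init => exact ⟨_, _, _, _, rfl, Abs.inv_init P V, sim_init P V b⟩
  | step σ l s s' _ hstep ih =>
    obtain ⟨A, L, h, t, rfl, hA, H⟩ := ih
    cases hstep with
    | enqInvoke u v hu =>
      refine ⟨_, _, h, t, ?_, hA.enqInvoke u v, H.of_enq (m' := s.mem) u [] ?_ H.tail le_rfl ?_ ?_
        ?_ ?_ rfl rfl rfl rfl fun _ => Iff.rfl⟩
      · rfl
      · rw [List.append_nil]; exact H.mem
      · intro u' hu'; simp [hu']
      · exact ⟨_, Function.update_self ..⟩
      · intro tmp new hp _; rw [List.append_nil]; exact hp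
      · simp [EnqPC.priv]
    | enqStep u m pc hs =>
      obtain ⟨A', L', t', h1, h2, h3⟩ := H.enq_step hA u hs
      exact ⟨A', L', h, t', by simp [h1], h2, h3⟩
    | enqReturn u hu =>
      have hr := H.enq u
      rw [hu] at hr
      obtain ⟨x, hx⟩ := hr
      refine ⟨_, _, h, t, ?_, hA.enqReturn u x hx, H.of_enq (m' := s.mem) u [] ?_ H.tail le_rfl ?_
        ?_ ?_ ?_ rfl rfl rfl rfl fun _ => Iff.rfl⟩
      · rfl
      · rw [List.append_nil]; exact H.mem
      · intro u' hu'; simp [hu']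
      · exact Function.update_self ..
      · intro tmp new hp _; rw [List.append_nil]; exact hp
      · simp [EnqPC.priv]
    | deqInvoke hd =>
      exact ⟨_, L, h, t, rfl, hA.deqInvoke,
        H.of_deq H.mem rfl rfl rfl (fun _ _ => id) ⟨_, rfl⟩⟩
    | deqStep m pc hs =>
      obtain ⟨A', h', h1, h2, h3⟩ := H.deq_step hb hA hs
      exact ⟨A', L, h', t, by simp [h1], h2, h3⟩
    | deqReturn r hd =>
      have hr := H.deq
      rw [hd] at hr
      obtain ⟨i, hi⟩ := hr
      exact ⟨_, L, h, t, rfl, hA.deqReturn i r hi,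
        H.of_deq H.mem rfl rfl rfl (fun _ _ => id) rfl⟩

end Jiffy

theorem mainTheorem1 {P V : Type*} [DecidableEq P] (bufferSize : ℕ) (hb : 0 < bufferSize)
    (σ : List (Jiffy.Event P V)) (hσ : Jiffy.IsExecution bufferSize σ) :
    Jiffy.Linearizable σ := by
  obtain ⟨s, hs⟩ := hσ
  obtain ⟨A, L, h, t, rfl, hA, -⟩ := hs.exists_sim hb
  exact hA.linearizable
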